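/- For an integer $k\ge 3$, consider the free product $G_k=\mathbb Z/k\mathbb Z\star\mathbb Z/k\mathbb Z$, the generators of the two cyclic groups being $a$ and $b$ respectively. Set $\Sigma_1=\{a,\dots,a^{k-1}\}$, $\Sigma_2=\{b,\dots,b^{k-1}\}$ and $\Sigma=\Sigma_1\sqcup\Sigma_2$; for $u\in\Sigma_j$ write $\Sigma_u=\Sigma_j$. Let $|g|_\Sigma$ be the word length of $g\in G_k$ with respect to the generating set $\Sigma$. Every $g\in G_k$ has a unique normal form $g=u_1\cdots u_n$ with $u_i\in\Sigma$ and $u_{i+1}\notin\Sigma_{u_i}$; let $L^\infty\subset\Sigma^{\mathbb N}$ be the set of infinite words satisfying the same condition. Let $(X_n)_{n\ge0}$ be the random walk $X_0=1$, $X_{n+1}=X_nx_n$, with $(x_n)$ i.i.d. of law $\mu$, where $\mu(a)=\mu(a^{-1})=\mu(b)=\mu(b^{-1})=1/4$. The drift of the walk is the constant $\gamma_k=\lim_n |X_n|_\Sigma/n$ (almost surely and in $L^1$). The harmonic measure is the law on $L^\infty$ of the random infinite word $X_\infty$ such that, almost surely, the length of the longest common prefix of the normal form of $X_n$ and of $X_\infty$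 tends to infinity. For $r:\Sigma\to(0,1)$ with $\sum_{u\in\Sigma}r(u)=1$, the Markovian multiplicative measure associated with $r$ is the law on $L^\infty$ of the Markov chain with initial distribution $r$ and transition probabilities $P_{u,v}=r(v)/\sum_{s\in\Sigma\setminus\Sigma_u}r(s)$ if $v\notin\Sigma_u$, and $P_{u,v}=0$ if $v\in\Sigma_u$. Let $F_0(x)=1$, $F_1(x)=x$ and $F_n(x)=2(2-x)F_{n-1}(x)-F_{n-2}(x)$ for $n\ge 2$. **Theorem.** For every $k\ge3$, the equation $F_k(x)=1$ has a unique solution $x_k$ in $(0,1)$; the harmonic measure of the walk exists and is the Markovian multiplicative measure associated with $r(a^i)=r(b^i)=F_i(x_k)/2$, $1\le i\le k-1$ (in particular these numbers are positive and sum to $1$); and the drift exists and equals $\gamma_k=(1-x_k)/2$. Moreover $\gamma_k$ is strictly increasing in $k\ge3$, and $\lim_{k\to\infty}\gamma_k=1/3$. -/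

import Mathlib

open MeasureTheory Filter Topology
open scoped ENNReal

noncomputable section

namespace FreeProductWalk

/-! ### Random walks on a group -/

section Walk

variable {Γ : Type*} [Group Γ]

/-- Length of `g` with respect to `S`: the least `n` such that `g` is a product of `n` elements
of `S`. -/
def wordLength (S : Set Γ) (g : Γ) : ℕ :=
  sInf {n : ℕ | ∃ l : List Γ, l.length = n ∧ (∀ s ∈ l, s ∈ S) ∧ l.prod = g}

/-- The walk with increments `x 0, x 1, …`: `X 0 = 1` and `X (n + 1) = X n * x n`. -/
def walk (x : ℕ → Γ) : ℕ → Γ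
  | 0 => 1
  | n + 1 => walk x n * x n

variable [MeasurableSpace Γ]

/-- The law of a sequence of independent increments with common law `μ`. -/
def incrementLaw (μ : Measure Γ) [IsProbabilityMeasure μ] : Measure (ℕ → Γ) :=
  Measure.infinitePi fun _ : ℕ => μ

/-- `γ` is the drift, with respect to the generators `S`, of the random walk with step law `μ`:
`|X n|_S / n` converges to `γ` almost surely and in `L¹`. -/
structure IsDrift (S : Set Γ) (μ : Measure Γ) [IsProbabilityMeasure μ] (γ : ℝ) : Prop where
  ae_tendsto : ∀ᵐ x ∂(incrementLaw μ),
    Tendsto (fun n : ℕ => (wordLength S (walk x n) : ℝ) / n) atTop (𝓝 γ)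
  tendsto_L1 : Tendsto (fun n : ℕ =>
    eLpNorm (fun x => (wordLength S (walk x n) : ℝ) / n - γ) 1 (incrementLaw μ)) atTop (𝓝 0)

end Walk

/-! ### The group `ℤ/kℤ ⋆ ℤ/kℤ` and its simple random walk -/

/-- The free product `ℤ/kℤ ⋆ ℤ/kℤ`; the factors are indexed by `false` and `true`. -/
abbrev ZkZk (k : ℕ) : Type := Monoid.CoprodI (fun _ : Bool => Multiplicative (ZMod k))

instance (k : ℕ) : MeasurableSpace (ZkZk k) := ⊤

/-- The generator of the first factor. -/
def a (k : ℕ) : ZkZk k :=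
  Monoid.CoprodI.of (M := fun _ : Bool => Multiplicative (ZMod k)) (i := false)
    (Multiplicative.ofAdd 1)

/-- The generator of the second factor. -/
def b (k : ℕ) : ZkZk k :=
  Monoid.CoprodI.of (M := fun _ : Bool => Multiplicative (ZMod k)) (i := true)
    (Multiplicative.ofAdd 1)

/-- The step law `μ(a) = μ(a⁻¹) = μ(b) = μ(b⁻¹) = 1/4`. -/
def stepLaw (k : ℕ) : Measure (ZkZk k) :=
  (4 : ℝ≥0∞)⁻¹ • (Measure.dirac (a k) + Measure.dirac (a k)⁻¹
    + Measure.dirac (b k) + Measure.dirac (b k)⁻¹)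

instance (k : ℕ) : IsProbabilityMeasure (stepLaw k) := by
  constructor
  simp only [stepLaw, Measure.smul_apply, Measure.add_apply, measure_univ, smul_eq_mul]
  rw [show (1 : ℝ≥0∞) + 1 + 1 + 1 = 4 by norm_num]
  exact ENNReal.inv_mul_cancel (by norm_num) (by norm_num)

/-- The alphabet `Σ = Σ₁ ⊔ Σ₂ = {a, …, a^(k-1)} ⊔ {b, …, b^(k-1)}`: the non-identity elements of
the two factors. -/
def Letter (k : ℕ) : Type := {s : Σ _ : Bool, Multiplicative (ZMod k) // s.2 ≠ 1}

instance (k : ℕ) : MeasurableSpace (Letter k) := ⊤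

variable {k : ℕ}

/-- The factor to which a letter belongs. -/
def Letter.factor (s : Letter k) : Bool := s.1.1

/-- The exponent `i ∈ {1, …, k-1}` of the letter `a^i` or `b^i` (for `k ≥ 1`). -/
def Letter.exponent (s : Letter k) : ℕ := ZMod.val (Multiplicative.toAdd s.1.2)

/-- A letter as an element of the group. -/
def Letter.toGroup (s : Letter k) : ZkZk k :=
  Monoid.CoprodI.of (M := fun _ : Bool => Multiplicative (ZMod k)) (i := s.1.1) s.1.2

/-- The set of generators `Σ` of `ℤ/kℤ ⋆ ℤ/kℤ`. -/
def generators (k : ℕ) : Set (ZkZk k) := Set.range (Letter.toGroup (k := k))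

/-- Infinite normal form words: consecutive letters lie in different factors. -/
def Boundary (k : ℕ) : Type :=
  {w : ℕ → Letter k // ∀ n, (w n).factor ≠ (w (n + 1)).factor}

instance (k : ℕ) : MeasurableSpace (Boundary k) :=
  inferInstanceAs (MeasurableSpace
    {w : ℕ → Letter k // ∀ n, (w n).factor ≠ (w (n + 1)).factor})

/-- The letters of the normal form of a group element. -/
def normalForm (g : ZkZk k) : List (Σ _ : Bool, Multiplicative (ZMod k)) :=
  (Monoid.CoprodI.Word.equiv g).toList

/-- Convergence of group elements to an infinite word: for every `m`, the `m`-th letter of the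
normal form is eventually the `m`-th letter of the infinite word. Equivalently, the length of
the longest common prefix tends to infinity. -/
def ConvergesTo (g : ℕ → ZkZk k) (w : Boundary k) : Prop :=
  ∀ m : ℕ, ∀ᶠ n in atTop, (normalForm (g n))[m]? = some (w.1 m).1

/-- `ν` is the harmonic measure of the random walk with step law `μ`: the walk converges almost
surely to a random infinite normal form word, whose law is `ν`. -/
def IsHarmonicMeasure (μ : Measure (ZkZk k)) [IsProbabilityMeasure μ]
    (ν : Measure (Boundary k)) : Prop :=
  ∃ Xinf : (ℕ → ZkZk k) → Boundary k,
    AEMeasurable Xinf (incrementLaw μ) ∧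
    (∀ᵐ x ∂(incrementLaw μ), ConvergesTo (walk x) (Xinf x)) ∧
    (incrementLaw μ).map Xinf = ν

/-! ### Markovian multiplicative measures -/

/-- The transition matrix attached to `r`: `P u v = r v / r(Σ ∖ Σ_u)` if `v` and `u` lie in
different factors, and `P u v = 0` otherwise. -/
def transition (r : Letter k → ℝ) (u v : Letter k) : ℝ :=
  if v.factor = u.factor then 0
  else r v / ∑ᶠ s : {s : Letter k // s.factor ≠ u.factor}, r s.1

/-- `ν` is the Markovian multiplicative measure associated with the positive probability vector
`r` on the alphabet: the law of the Markov chain of letters with initial law `r` and transition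
matrix `transition r`. -/
structure IsMarkovianMultiplicative (r : Letter k → ℝ) (ν : Measure (Boundary k)) : Prop where
  pos : ∀ s, 0 < r s
  sum_eq_one : ∑ᶠ s, r s = 1
  isProbabilityMeasure : IsProbabilityMeasure ν
  cylinder : ∀ (n : ℕ) (u : Fin (n + 1) → Letter k),
    ν {w | ∀ i : Fin (n + 1), w.1 i = u i} =
      ENNReal.ofReal (r (u 0) * ∏ i : Fin n, transition r (u i.castSucc) (u i.succ))

/-! ### The polynomials `F n` -/

/-- `F 0 = 1`, `F 1 = x`, `F n = 2 (2 - x) F (n - 1) - F (n - 2)`. -/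
def F : ℕ → ℝ → ℝ
  | 0, _ => 1
  | 1, x => x
  | n + 2, x => 2 * (2 - x) * F (n + 1) x - F n x

end FreeProductWalk

end

/-!
An even function `w` on `ℤ/kℤ` with `w 0 = 1` extends multiplicatively to normal forms, and the
extension is harmonic off `1` exactly when `w (m + 1) = 2 (2 - w 1) w m - w (m - 1)` for `m ≠ 0`.
So `w m = F m x`, with `F k x = 1` for periodicity, and `w` gives the probability of ever visiting
`1`. By symmetry the limit word of the walk from `1` starts in either factor with probability
`1 / 2`, and harmonic functions built from `w` give its law: its cylinders have measure
`(∏ w (eᵢ)) / 2`, and its exponents are independent with law `w`.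

For the drift, let `v m = m (k - m)`, extended additively to normal forms. Corrected by a multiple
of `w`, it has mean increment `c = (k - 2) / 2` everywhere, so it grows like `c n` along the walk.
At the last visit to length `m` it is a sum over the first `m` exponents of the limit word, hence
close to `m ∑ w v`; so the drift is `c / ∑ w v`, and summation by parts turns this into
`(1 - x) / 2`.

With `2 - x = (q + 1/q) / 2` and `0 < q < 1`, the equation `F k x = 1` becomes
`1 + q ^ k = 2 (q + ⋯ + q ^ (k - 1))`. The difference of the two sides decreases in `q` and in `k`,
so `q`, and with it `x`, is unique and decreases with `k`; as `k → ∞`, `q` tends to `1 / 3`, where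
`x = 1 / 3`.
-/

noncomputable section

namespace FreeProductWalk

/-! ### Random walks on a countable group -/

section Increments

variable {Γ : Type*} [MeasurableSpace Γ] {μ : Measure Γ} [IsProbabilityMeasure μ]

instance : IsProbabilityMeasure (incrementLaw μ) := by
  unfold incrementLaw; infer_instance

lemma map_eval_incrementLaw (n : ℕ) : (incrementLaw μ).map (fun x => x n) = μ :=
  Measure.infinitePi_map_eval (fun _ : ℕ => μ) n

lemma ae_incrementLaw_forall {p : Γ → Prop} (h : ∀ᵐ s ∂μ, p s) :
    ∀ᵐ x ∂incrementLaw μ, ∀ n, p (x n) :=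
  ae_all_iff.2 fun n => ae_of_ae_map (measurable_pi_apply n).aemeasurable <| by
    rwa [map_eval_incrementLaw]

end Increments

section Walk

variable {Γ : Type*} [Group Γ]

lemma walk_congr {x y : ℕ → Γ} {n : ℕ} (h : ∀ i < n, x i = y i) : walk x n = walk y n := by
  induction n with
  | zero => rfl
  | succ n ih => simp only [walk, h n n.lt_succ_self, ih fun i hi => h i (hi.trans n.lt_succ_self)]

variable [MeasurableSpace Γ] [DiscreteMeasurableSpace Γ] {μ : Measure Γ} [IsProbabilityMeasure μ]
  {U : Γ → ℝ} {B : NNReal} {c : ℝ}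

lemma lintegral_exp_increment_le (hU : ∀ g, ∀ᵐ s ∂μ, |U (g * s) - U g| ≤ B)
    (hc : ∀ g, ∫ s, (U (g * s) - U g) ∂μ = c) (t : ℝ) (g : Γ) :
    ∫⁻ s, ENNReal.ofReal (Real.exp (t * (U (g * s) - U g - c))) ∂μ
      ≤ ENNReal.ofReal (Real.exp (B ^ 2 * t ^ 2 / 2)) := by
  have hsub := ProbabilityTheory.hasSubgaussianMGF_of_mem_Icc (μ := μ)
    (X := fun s => U (g * s) - U g) Measurable.of_discrete.aemeasurable
    ((hU g).mono fun s hs => abs_le.1 hs)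
  simp only [hc] at hsub
  rw [← ofReal_integral_eq_lintegral_ofReal (hsub.integrable_exp_mul t)
    (.of_forall fun _ => (Real.exp_pos _).le)]
  refine ENNReal.ofReal_le_ofReal ((hsub.mgf_le t).trans_eq ?_)
  have : |(B : ℝ) + B| / 2 = B := by rw [abs_of_nonneg (by positivity)]; ring
  simp [this]

variable [Countable Γ]

lemma measurable_walk (n : ℕ) : Measurable fun x : ℕ → Γ => walk x n := by
  induction n with
  | zero => exact measurable_const
  | succ n ih =>
    exact (Measurable.of_discrete (f := fun p : Γ × Γ => p.1 * p.2)).comp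
      (ih.prodMk (measurable_pi_apply n))

lemma indepFun_walk_increment (n : ℕ) :
    ProbabilityTheory.IndepFun (fun x : ℕ → Γ => walk x n) (fun x => x n) (incrementLaw μ) := by
  have hind : ProbabilityTheory.iIndepFun (fun (i : ℕ) (x : ℕ → Γ) => x i) (incrementLaw μ) :=
    ProbabilityTheory.iIndepFun_infinitePi (P := fun _ : ℕ => μ) (X := fun _ => id)
      fun _ => measurable_id
  have hfin := hind.indepFun_finset (Finset.range n) {n} (by simp) fun i => measurable_pi_apply i
  let walkOf : (Finset.range n → Γ) → Γ := fun y =>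
    walk (fun i => if h : i ∈ Finset.range n then y ⟨i, h⟩ else 1) n
  have hwalk : (fun x : ℕ → Γ => walk x n) = walkOf ∘ fun x i => x i :=
    funext fun x => walk_congr fun i hi => by simp [hi]
  rw [hwalk]
  exact hfin.comp .of_discrete (measurable_pi_apply (⟨n, by simp⟩ : ({n} : Finset ℕ)))

lemma lintegral_walk_succ (f : Γ → ℝ≥0∞) (n : ℕ) :
    ∫⁻ x, f (walk x (n + 1)) ∂incrementLaw μ
      = ∫⁻ x, ∫⁻ s, f (walk x n * s) ∂μ ∂incrementLaw μ := by
  have hjoint : (incrementLaw μ).map (fun x => (walk x n, x n))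
      = ((incrementLaw μ).map fun x => walk x n).prod μ := by
    rw [(ProbabilityTheory.indepFun_iff_map_prod_eq_prod_map_map (measurable_walk n).aemeasurable
      (measurable_pi_apply n).aemeasurable).1 (indepFun_walk_increment n), map_eval_incrementLaw]
  calc ∫⁻ x, f (walk x (n + 1)) ∂incrementLaw μ
      = ∫⁻ p, f (p.1 * p.2) ∂(incrementLaw μ).map fun x => (walk x n, x n) := by
        rw [lintegral_map .of_discrete ((measurable_walk n).prodMk (measurable_pi_apply n))]
        rfl
    _ = ∫⁻ x, ∫⁻ s, f (walk x n * s) ∂μ ∂incrementLaw μ := by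
        rw [hjoint, lintegral_prod _ Measurable.of_discrete.aemeasurable,
          lintegral_map .of_discrete (measurable_walk n)]

lemma lintegral_walk_of_harmonic {f : Γ → ℝ≥0∞} (hf : ∀ g, ∫⁻ s, f (g * s) ∂μ = f g) (n : ℕ) :
    ∫⁻ x, f (walk x n) ∂incrementLaw μ = f 1 := by
  induction n with
  | zero => simp [walk]
  | succ n ih => simp_rw [lintegral_walk_succ, hf, ih]

/-- Optional stopping at time infinity: the bounded martingale `f (walk x n)` keeps its mean. -/
lemma measure_eq_of_harmonic {f : Γ → ℝ} (hf : ∀ g, ∫ s, f (g * s) ∂μ = f g)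
    (hf01 : ∀ g, f g ∈ Set.Icc 0 1) {S : Set (ℕ → Γ)} (hS : MeasurableSet S)
    (hlim : ∀ᵐ x ∂incrementLaw μ, Tendsto (fun n => f (walk x n)) atTop (𝓝 (S.indicator 1 x))) :
    incrementLaw μ S = ENNReal.ofReal (f 1) := by
  have hharm (g : Γ) : ∫⁻ s, ENNReal.ofReal (f (g * s)) ∂μ = ENNReal.ofReal (f g) := by
    rw [← hf g, ofReal_integral_eq_lintegral_ofReal
      (.of_mem_Icc 0 1 Measurable.of_discrete.aemeasurable (.of_forall fun s => hf01 (g * s)))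
      (.of_forall fun s => (hf01 (g * s)).1)]
  have hconv := tendsto_lintegral_of_dominated_convergence (μ := incrementLaw μ)
    (F := fun n x => ENNReal.ofReal (f (walk x n))) (f := S.indicator 1) (fun _ => 1)
    (fun n => (Measurable.of_discrete (f := fun g => ENNReal.ofReal (f g))).comp
      (measurable_walk n))
    (fun n => .of_forall fun x => ENNReal.ofReal_le_one.2 (hf01 _).2) (by simp) ?_
  · simp only [lintegral_walk_of_harmonic (f := fun g => ENNReal.ofReal (f g)) hharm,
      lintegral_indicator_one hS] at hconv
    exact tendsto_nhds_unique hconv tendsto_const_nhds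
  · filter_upwards [hlim] with x hx
    convert ENNReal.tendsto_ofReal hx using 2
    by_cases h : x ∈ S <;> simp [h]

lemma lintegral_exp_walk_le (hU : ∀ g, ∀ᵐ s ∂μ, |U (g * s) - U g| ≤ B)
    (hc : ∀ g, ∫ s, (U (g * s) - U g) ∂μ = c) (t : ℝ) (n : ℕ) :
    ∫⁻ x, ENNReal.ofReal (Real.exp (t * (U (walk x n) - U 1 - n * c))) ∂incrementLaw μ
      ≤ ENNReal.ofReal (Real.exp (n * B ^ 2 * t ^ 2 / 2)) := by
  induction n with
  | zero => simp [walk]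
  | succ n ih =>
    rw [lintegral_walk_succ
      fun g => ENNReal.ofReal (Real.exp (t * (U g - U 1 - (n + 1 : ℕ) * c)))]
    have hsplit (g s : Γ) :
        ENNReal.ofReal (Real.exp (t * (U (g * s) - U 1 - (n + 1 : ℕ) * c)))
          = ENNReal.ofReal (Real.exp (t * (U g - U 1 - n * c)))
            * ENNReal.ofReal (Real.exp (t * (U (g * s) - U g - c))) := by
      rw [← ENNReal.ofReal_mul (Real.exp_pos _).le, ← Real.exp_add]
      push_cast
      ring_nf
    simp_rw [hsplit, lintegral_const_mul' _ _ ENNReal.ofReal_ne_top]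
    calc ∫⁻ x, ENNReal.ofReal (Real.exp (t * (U (walk x n) - U 1 - n * c)))
            * ∫⁻ s, ENNReal.ofReal (Real.exp (t * (U (walk x n * s) - U (walk x n) - c))) ∂μ
            ∂incrementLaw μ
        ≤ ∫⁻ x, ENNReal.ofReal (Real.exp (t * (U (walk x n) - U 1 - n * c)))
            * ENNReal.ofReal (Real.exp (B ^ 2 * t ^ 2 / 2)) ∂incrementLaw μ :=
          lintegral_mono fun x => by gcongr; exact lintegral_exp_increment_le hU hc t _
      _ ≤ ENNReal.ofReal (Real.exp (n * B ^ 2 * t ^ 2 / 2))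
            * ENNReal.ofReal (Real.exp (B ^ 2 * t ^ 2 / 2)) := by
          rw [lintegral_mul_const' _ _ ENNReal.ofReal_ne_top]
          gcongr
      _ = ENNReal.ofReal (Real.exp ((n + 1 : ℕ) * B ^ 2 * t ^ 2 / 2)) := by
          rw [← ENNReal.ofReal_mul (Real.exp_pos _).le, ← Real.exp_add]
          push_cast
          ring_nf

lemma hasSubgaussianMGF_walk (hU : ∀ g, ∀ᵐ s ∂μ, |U (g * s) - U g| ≤ B)
    (hc : ∀ g, ∫ s, (U (g * s) - U g) ∂μ = c) (n : ℕ) :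
    ProbabilityTheory.HasSubgaussianMGF (fun x => U (walk x n) - U 1 - n * c) (n * B ^ 2)
      (incrementLaw μ) := by
  have hmeas (t : ℝ) : Measurable fun x : ℕ → Γ => Real.exp (t * (U (walk x n) - U 1 - n * c)) :=
    (Measurable.of_discrete (f := fun g => Real.exp (t * (U g - U 1 - n * c)))).comp
      (measurable_walk n)
  have hintegrable (t : ℝ) : Integrable (fun x => Real.exp (t * (U (walk x n) - U 1 - n * c)))
      (incrementLaw μ) := by
    refine ⟨(hmeas t).aestronglyMeasurable, ?_⟩
    rw [hasFiniteIntegral_iff_ofReal (.of_forall fun _ => (Real.exp_pos _).le)]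
    exact (lintegral_exp_walk_le hU hc t n).trans_lt ENNReal.ofReal_lt_top
  refine ⟨hintegrable, fun t => ?_⟩
  rw [ProbabilityTheory.mgf, ← ENNReal.ofReal_le_ofReal_iff (Real.exp_pos _).le,
    ofReal_integral_eq_lintegral_ofReal (hintegrable t) (.of_forall fun _ => (Real.exp_pos _).le)]
  simpa using lintegral_exp_walk_le hU hc t n

lemma ae_eventually_walk_lt (hB : 0 < B) (hU : ∀ g, ∀ᵐ s ∂μ, |U (g * s) - U g| ≤ B)
    (hc : ∀ g, ∫ s, (U (g * s) - U g) ∂μ = c) {ε : ℝ} (hε : 0 < ε) :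
    ∀ᵐ x ∂incrementLaw μ, ∀ᶠ n : ℕ in atTop, U (walk x n) - U 1 - n * c < n * ε := by
  have hbound (n : ℕ) :
      (incrementLaw μ).real {x | n * ε ≤ U (walk x n) - U 1 - n * c}
        ≤ Real.exp (n * -(ε ^ 2 / (2 * B ^ 2))) := by
    refine ((hasSubgaussianMGF_walk hU hc n).measure_ge_le (by positivity)).trans_eq ?_
    rcases n.eq_zero_or_pos with rfl | hn
    · simp
    · congr 1
      push_cast
      field_simp
  have hsum : ∑' n : ℕ, incrementLaw μ {x | n * ε ≤ U (walk x n) - U 1 - n * c} ≠ ⊤ := by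
    have hdecay : -(ε ^ 2 / (2 * (B : ℝ) ^ 2)) < 0 := neg_lt_zero.2 (by positivity)
    refine ne_top_of_le_ne_top (Real.summable_exp_nat_mul_iff.2 hdecay).tsum_ofReal_ne_top
      (ENNReal.tsum_le_tsum fun n => ?_)
    rw [← ofReal_measureReal]
    exact ENNReal.ofReal_le_ofReal (hbound n)
  filter_upwards [ae_eventually_notMem hsum] with x hx
  filter_upwards [hx] with n hn
  exact not_le.1 hn

lemma ae_tendsto_walk_div {B : ℝ} (hU : ∀ g, ∀ᵐ s ∂μ, |U (g * s) - U g| ≤ B)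
    (hc : ∀ g, ∫ s, (U (g * s) - U g) ∂μ = c) :
    ∀ᵐ x ∂incrementLaw μ, Tendsto (fun n : ℕ => U (walk x n) / n) atTop (𝓝 c) := by
  let B' : NNReal := ⟨|B| + 1, by positivity⟩
  have hB' : 0 < B' := show 0 < |B| + 1 by positivity
  have hU' (g : Γ) : ∀ᵐ s ∂μ, |U (g * s) - U g| ≤ B' :=
    (hU g).mono fun s hs => hs.trans ((le_abs_self B).trans (lt_add_one _).le)
  have hneg : ∀ g, ∫ s, (-U (g * s) - -U g) ∂μ = -c := fun g => by
    rw [← hc g, ← integral_neg]; simp [neg_add_eq_sub]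
  have hupper (m : ℕ) := ae_eventually_walk_lt hB' hU' hc (Nat.one_div_pos_of_nat (n := m))
  have hlower (m : ℕ) := ae_eventually_walk_lt hB' (U := fun g => -U g)
    (fun g => (hU' g).mono fun s hs => by rwa [neg_sub_neg, abs_sub_comm]) hneg
    (Nat.one_div_pos_of_nat (n := m))
  filter_upwards [ae_all_iff.2 hupper, ae_all_iff.2 hlower] with x hup hlow
  have hcentered : Tendsto (fun n : ℕ => (U (walk x n) - U 1 - n * c) / n) atTop (𝓝 0) := by
    refine Metric.tendsto_atTop'.2 fun ε hε => ?_
    obtain ⟨m, hm⟩ := exists_nat_one_div_lt hε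
    obtain ⟨N, hN⟩ := eventually_atTop.1 ((hup m).and (hlow m))
    refine ⟨N, fun n hn => ?_⟩
    have hn0 : (0 : ℝ) < n := by exact_mod_cast N.zero_le.trans_lt hn
    rw [Real.dist_0_eq_abs, abs_div, abs_of_pos hn0, div_lt_iff₀ hn0]
    have := mul_lt_mul_of_pos_left hm hn0
    exact abs_lt.2 ⟨by linarith [(hN n hn.le).2], by linarith [(hN n hn.le).1]⟩
  have hsum := (hcentered.add (tendsto_const_div_atTop_nhds_zero_nat (U 1))).add_const c
  simp only [zero_add] at hsum
  refine hsum.congr' ?_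
  filter_upwards [eventually_ne_atTop 0] with n hn
  field_simp
  ring

lemma isDrift_of_ae_tendsto {S : Set Γ} {γ : ℝ}
    (hle : ∀ᵐ x ∂incrementLaw μ, ∀ n, wordLength S (walk x n) ≤ n)
    (h : ∀ᵐ x ∂incrementLaw μ,
      Tendsto (fun n : ℕ => (wordLength S (walk x n) : ℝ) / n) atTop (𝓝 γ)) :
    IsDrift S μ γ := by
  refine ⟨h, ?_⟩
  simp only [eLpNorm_one_eq_lintegral_enorm]
  rw [← lintegral_zero (μ := incrementLaw μ)]
  refine tendsto_lintegral_of_dominated_convergence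
    (fun _ => ENNReal.ofReal (1 + |γ|)) (fun n => ?_) (fun n => ?_) (by simp) ?_
  · exact (Measurable.of_discrete (f := fun g : Γ => ‖(wordLength S g : ℝ) / n - γ‖ₑ)).comp
      (measurable_walk n)
  · filter_upwards [hle] with x hx
    rw [← ofReal_norm]
    refine ENNReal.ofReal_le_ofReal ((norm_sub_le _ _).trans (add_le_add ?_ le_rfl))
    rw [Real.norm_of_nonneg (by positivity)]
    exact div_le_one_of_le₀ (by exact_mod_cast hx n) (Nat.cast_nonneg n)
  · filter_upwards [h] with x hx
    simpa using (hx.sub_const γ).enorm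

end Walk

/-- The limit is interpolated between the times `e m` because `n - ℓ n` is monotone. -/
lemma tendsto_div_of_succ_le_of_tendsto_div_subseq {ℓ e : ℕ → ℕ} {γ : ℝ}
    (hstep : ∀ n, ℓ (n + 1) ≤ ℓ n + 1) (he : Tendsto e atTop atTop)
    (hratio : Tendsto (fun m => (e (m + 1) : ℝ) / e m) atTop (𝓝 1))
    (hℓ : Tendsto (fun m => (ℓ (e m) : ℝ) / e m) atTop (𝓝 γ)) :
    Tendsto (fun n => (ℓ n : ℝ) / n) atTop (𝓝 γ) := by
  have he0 : ∀ᶠ m in atTop, (0 : ℝ) < e m := by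
    filter_upwards [he.eventually_gt_atTop 0] with m hm using by exact_mod_cast hm
  have hdef : Tendsto (fun n : ℕ => ((n : ℝ) - ℓ n) / n) atTop (𝓝 (1 - γ)) := by
    refine tendsto_div_of_monotone_of_exists_subseq_tendsto_div _ _
      (monotone_nat_of_le_succ fun n => ?_) fun r hr => ⟨e, ?_, he, ?_⟩
    · have : (ℓ (n + 1) : ℝ) ≤ ℓ n + 1 := by exact_mod_cast hstep n
      push_cast
      linarith
    · filter_upwards [hratio.eventually_lt_const hr, he0] with m hm hm0
      exact (div_le_iff₀ hm0).1 hm.le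
    · refine (hℓ.const_sub 1).congr' ?_
      filter_upwards [he0] with m hm
      rw [sub_div, div_self hm.ne']
  have hcomp := hdef.const_sub 1
  simp only [sub_sub_cancel] at hcomp
  refine hcomp.congr' ?_
  filter_upwards [eventually_gt_atTop 0] with n hn
  have : (n : ℝ) ≠ 0 := by positivity
  field_simp
  ring

/-! ### Normal forms -/

section NormalForm

variable {k : ℕ}

/-- A syllable: an element of one of the two factors. -/
abbrev Syllable (k : ℕ) : Type := Σ _ : Bool, Multiplicative (ZMod k)

/-- The exponent of a syllable, as a residue modulo `k`. -/
def residue (l : Syllable k) : ZMod k := Multiplicative.toAdd l.2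

/-- The syllable `a ^ m` (for `i = false`) or `b ^ m` (for `i = true`). -/
def syllable (i : Bool) (m : ZMod k) : Syllable k := ⟨i, Multiplicative.ofAdd m⟩

@[simp] lemma syllable_fst (i : Bool) (m : ZMod k) : (syllable i m).1 = i := rfl

@[simp] lemma syllable_residue (i : Bool) (m : ZMod k) : residue (syllable i m) = m := rfl

lemma syllable_snd_ne_one {i : Bool} {m : ZMod k} : (syllable i m).2 ≠ 1 ↔ m ≠ 0 := Iff.rfl

/-- The group element `a ^ m` (for `i = false`) or `b ^ m` (for `i = true`). -/
def ofFactor (i : Bool) (m : ZMod k) : ZkZk k :=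
  Monoid.CoprodI.of (M := fun _ : Bool => Multiplicative (ZMod k)) (i := i)
    (Multiplicative.ofAdd m)

@[simp] lemma ofFactor_zero (i : Bool) : ofFactor i (0 : ZMod k) = 1 := by
  rw [ofFactor, ofAdd_zero, map_one]

lemma ofFactor_mul_ofFactor (i : Bool) (m m' : ZMod k) :
    ofFactor i m * ofFactor i m' = ofFactor i (m + m') := by
  simp only [ofFactor, ofAdd_add, map_mul]

lemma ofFactor_inv (i : Bool) (m : ZMod k) : (ofFactor i m)⁻¹ = ofFactor i (-m) := by
  simp only [ofFactor, ofAdd_neg, map_inv]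

/-- A list of syllables which is a normal form. -/
def Reduced (L : List (Syllable k)) : Prop :=
  (∀ l ∈ L, l.2 ≠ 1) ∧ L.IsChain fun l l' => l.1 ≠ l'.1

/-- The product in the group of a list of syllables. -/
def listProd (L : List (Syllable k)) : ZkZk k := (L.map fun l => ofFactor l.1 (residue l)).prod

lemma listProd_append (L L' : List (Syllable k)) :
    listProd (L ++ L') = listProd L * listProd L' := by
  simp [listProd]

lemma listProd_singleton (l : Syllable k) : listProd [l] = ofFactor l.1 (residue l) := by
  simp [listProd]

lemma reduced_nil : Reduced ([] : List (Syllable k)) := ⟨by simp, by simp⟩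

lemma reduced_append {L L' : List (Syllable k)} :
    Reduced (L ++ L') ↔ Reduced L ∧ Reduced L' ∧
      ∀ l ∈ L.getLast?, ∀ l' ∈ L'.head?, l.1 ≠ l'.1 := by
  simp only [Reduced, List.isChain_append, List.forall_mem_append]
  tauto

lemma reduced_normalForm (g : ZkZk k) : Reduced (normalForm g) :=
  ⟨(Monoid.CoprodI.Word.equiv g).ne_one, (Monoid.CoprodI.Word.equiv g).chain_ne⟩

lemma listProd_normalForm (g : ZkZk k) : listProd (normalForm g) = g :=
  Monoid.CoprodI.Word.equiv.symm_apply_apply g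

lemma normalForm_listProd {L : List (Syllable k)} (h : Reduced L) :
    normalForm (listProd L) = L :=
  congrArg Monoid.CoprodI.Word.toList
    (Monoid.CoprodI.Word.equiv.apply_symm_apply
      (⟨L, h.1, h.2⟩ : Monoid.CoprodI.Word fun _ : Bool => Multiplicative (ZMod k)))

lemma normalForm_injective : Function.Injective (normalForm (k := k)) := fun g h e => by
  rw [← listProd_normalForm g, e, listProd_normalForm]

@[simp] lemma normalForm_one : normalForm (1 : ZkZk k) = [] := by
  simpa [listProd] using normalForm_listProd (reduced_nil (k := k))

lemma normalForm_eq_nil {g : ZkZk k} : normalForm g = [] ↔ g = 1 := by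
  rw [← normalForm_one, normalForm_injective.eq_iff]

lemma normalForm_mul {g h : ZkZk k}
    (hgh : ∀ l ∈ (normalForm g).getLast?, ∀ l' ∈ (normalForm h).head?, l.1 ≠ l'.1) :
    normalForm (g * h) = normalForm g ++ normalForm h := by
  conv_lhs => rw [← listProd_normalForm g, ← listProd_normalForm h, ← listProd_append]
  exact normalForm_listProd
    (reduced_append.2 ⟨reduced_normalForm g, reduced_normalForm h, hgh⟩)

/-- The normal form of `ofFactor i m`. -/
def tail (i : Bool) (m : ZMod k) : List (Syllable k) := if m = 0 then [] else [syllable i m]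

@[simp] lemma tail_zero (i : Bool) : tail i (0 : ZMod k) = [] := if_pos rfl

lemma tail_of_ne {i : Bool} {m : ZMod k} (h : m ≠ 0) : tail i m = [syllable i m] := if_neg h

lemma length_tail_le (i : Bool) (m : ZMod k) : (tail i m).length ≤ 1 := by
  unfold tail; split_ifs <;> simp

lemma fst_eq_of_mem_head?_tail {i : Bool} {m : ZMod k} {l : Syllable k}
    (h : l ∈ (tail i m).head?) : l.1 = i := by
  by_cases hm : m = 0
  · simp [hm] at h
  · rw [tail_of_ne hm, List.head?_cons, Option.mem_some_iff] at h
    exact h ▸ rfl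

@[simp] lemma normalForm_ofFactor (i : Bool) (m : ZMod k) :
    normalForm (ofFactor i m) = tail i m := by
  by_cases hm : m = 0
  · simp [hm]
  · rw [tail_of_ne hm, ← normalForm_listProd (L := [syllable i m])
      ⟨by simpa using syllable_snd_ne_one.2 hm, by simp⟩, listProd_singleton]
    rfl

variable {g : ZkZk k} {L : List (Syllable k)} {i j : Bool} {m : ZMod k}

lemma normalForm_mul_same (h : normalForm g = L ++ [syllable j m]) (m' : ZMod k) :
    normalForm (g * ofFactor j m') = L ++ tail j (m + m') := by
  have hr := reduced_normalForm g
  rw [h, reduced_append] at hr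
  have hg : g * ofFactor j m' = listProd L * ofFactor j (m + m') := by
    rw [← listProd_normalForm g, h, listProd_append, listProd_singleton, syllable_fst,
      syllable_residue, mul_assoc, ofFactor_mul_ofFactor]
  rw [hg, normalForm_mul, normalForm_listProd hr.1, normalForm_ofFactor]
  rw [normalForm_listProd hr.1, normalForm_ofFactor]
  exact fun l hl l' hl' => fst_eq_of_mem_head?_tail hl' ▸ hr.2.2 l hl _ rfl

lemma normalForm_mul_other (h : normalForm g = L ++ [syllable j m]) (hij : i ≠ j) (m' : ZMod k) :
    normalForm (g * ofFactor i m') = normalForm g ++ tail i m' := by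
  rw [normalForm_mul, normalForm_ofFactor]
  rw [normalForm_ofFactor, h, List.getLast?_concat]
  rintro l ⟨⟩ l' hl'
  rw [fst_eq_of_mem_head?_tail hl']
  exact hij.symm

lemma eq_one_or_exists_last (g : ZkZk k) :
    g = 1 ∨ ∃ L j m, m ≠ 0 ∧ normalForm g = L ++ [syllable j m] := by
  rcases List.eq_nil_or_concat (normalForm g) with h | ⟨L, l, h⟩
  · exact .inl (normalForm_eq_nil.1 h)
  · rw [List.concat_eq_append] at h
    exact .inr ⟨L, l.1, residue l, (reduced_normalForm g).1 l (h ▸ by simp), h⟩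

lemma exists_normalForm_mul (g : ZkZk k) (i : Bool) (m : ZMod k) :
    ∃ L A B : List (Syllable k), A.length ≤ 1 ∧ B.length ≤ 1 ∧
      normalForm g = L ++ A ∧ normalForm (g * ofFactor i m) = L ++ B := by
  rcases eq_one_or_exists_last g with rfl | ⟨L, j, m', -, h⟩
  · exact ⟨[], [], tail i m, by simp, length_tail_le i m, by simp, by simp⟩
  · by_cases hij : i = j
    · subst hij
      exact ⟨L, _, tail i (m' + m), by simp, length_tail_le _ _, h, normalForm_mul_same h m⟩
    · exact ⟨normalForm g, [], tail i m, by simp, length_tail_le _ _, by simp,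
        normalForm_mul_other h hij m⟩

/-- The number of syllables of the normal form. -/
def len (g : ZkZk k) : ℕ := (normalForm g).length

@[simp] lemma len_one : len (1 : ZkZk k) = 0 := by simp [len]

lemma len_mul_ofFactor_le (g : ZkZk k) (i : Bool) (m : ZMod k) :
    len (g * ofFactor i m) ≤ len g + 1 := by
  obtain ⟨L, A, B, -, hB, h1, h2⟩ := exists_normalForm_mul g i m
  simp only [len, h1, h2, List.length_append]
  omega

lemma take_normalForm_mul_ofFactor {d : ℕ} (hd : d < len g) (i : Bool) (m : ZMod k) :
    (normalForm (g * ofFactor i m)).take d = (normalForm g).take d := by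
  obtain ⟨L, A, B, hA, -, h1, h2⟩ := exists_normalForm_mul g i m
  have hdL : d ≤ L.length := by
    simp only [len, h1, List.length_append] at hd
    omega
  rw [h1, h2, List.take_append_of_le_length hdL, List.take_append_of_le_length hdL]

lemma len_mul_prod_le (g : ZkZk k) {l : List (ZkZk k)} (hl : ∀ s ∈ l, s ∈ generators k) :
    len (g * l.prod) ≤ len g + l.length := by
  induction l using List.reverseRecOn with
  | nil => simp
  | append_singleton l s ih =>
    obtain ⟨u, rfl⟩ := hl s (by simp)
    rw [List.prod_append, List.prod_singleton, ← mul_assoc, List.length_append,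
      List.length_singleton, ← add_assoc]
    exact (len_mul_ofFactor_le _ u.1.1 (residue u.1)).trans
      (Nat.add_le_add_right (ih fun s hs => hl s (by simp [hs])) 1)

lemma exists_prod_generators_eq (g : ZkZk k) :
    ∃ l : List (ZkZk k), l.length = len g ∧ (∀ s ∈ l, s ∈ generators k) ∧ l.prod = g := by
  refine ⟨_, List.length_map _, fun s hs => ?_, listProd_normalForm g⟩
  obtain ⟨l, hl, rfl⟩ := List.mem_map.1 hs
  exact ⟨⟨l, (reduced_normalForm g).1 l hl⟩, rfl⟩

lemma wordLength_generators (g : ZkZk k) : wordLength (generators k) g = len g := by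
  refine le_antisymm (Nat.sInf_le (exists_prod_generators_eq g))
    (le_csInf ⟨_, exists_prod_generators_eq g⟩ ?_)
  rintro _ ⟨l, rfl, hl, rfl⟩
  simpa using len_mul_prod_le 1 hl

lemma len_mul_le (g h : ZkZk k) : len (g * h) ≤ len g + len h := by
  obtain ⟨l, hlen, hl, rfl⟩ := exists_prod_generators_eq h
  exact hlen ▸ len_mul_prod_le g hl

lemma normalForm_inv (g : ZkZk k) :
    normalForm g⁻¹ = ((normalForm g).map fun l => syllable l.1 (-residue l)).reverse := by
  obtain ⟨hne, hchain⟩ := reduced_normalForm g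
  have hred : Reduced ((normalForm g).map fun l => syllable l.1 (-residue l)).reverse := by
    refine ⟨fun l hl => ?_, ?_⟩
    · obtain ⟨l', hl', rfl⟩ := List.mem_map.1 (List.mem_reverse.1 hl)
      exact syllable_snd_ne_one.2 (neg_ne_zero.2 (hne l' hl'))
    · rw [List.isChain_reverse, List.isChain_map]
      exact hchain.imp fun _ _ h => h.symm
  rw [← normalForm_listProd hred]
  congr 1
  conv_lhs => rw [← listProd_normalForm g]
  simp [listProd, List.prod_inv_reverse, Function.comp_def, ofFactor_inv]

/-- `g` begins with a syllable of the factor `c`. -/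
def StartsIn (c : Bool) (g : ZkZk k) : Prop := ∃ l ∈ (normalForm g).head?, l.1 = c

lemma startsIn_inv_mul_iff {h : ZkZk k} (hg : normalForm g = L ++ [syllable j m]) :
    StartsIn (!j) (g⁻¹ * h) ↔ normalForm g <+: normalForm h ∧ len g < len h := by
  have hlast : (normalForm g).getLast? = some (syllable j m) := by rw [hg, List.getLast?_concat]
  constructor
  · rintro ⟨l, hl, hlj⟩
    have hcat : normalForm h = normalForm g ++ normalForm (g⁻¹ * h) := by
      rw [← normalForm_mul, mul_inv_cancel_left]
      rw [hlast]
      rintro _ ⟨⟩ l' hl'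
      rw [Option.mem_unique hl' hl, hlj]
      simp
    refine ⟨hcat ▸ List.prefix_append _ _, ?_⟩
    rw [len, len, hcat, List.length_append, Nat.lt_add_right_iff_pos, List.length_pos_iff_ne_nil]
    rintro hnil
    simp [hnil] at hl
  · rintro ⟨⟨L', hL'⟩, hlen⟩
    have hr := reduced_normalForm h
    rw [← hL', reduced_append] at hr
    have hnf : normalForm (g⁻¹ * h) = L' := by
      rw [← normalForm_listProd hr.2.1, ← listProd_normalForm h, ← hL', listProd_append,
        listProd_normalForm, inv_mul_cancel_left]
    rcases L' with _ | ⟨s, t⟩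
    · simp [len, ← hL'] at hlen
    · exact ⟨s, by simp [hnf], Bool.eq_not_of_ne (hr.2.2 _ hlast s rfl).symm⟩

end NormalForm

/-! ### One step of the walk -/

section StepLaw

variable {k : ℕ}

instance : Countable (Multiplicative (ZMod k)) :=
  match k with
  | 0 => inferInstanceAs (Countable ℤ)
  | n + 1 => inferInstanceAs (Countable (Fin (n + 1)))

instance : Countable (ZkZk k) := normalForm_injective.countable

instance : DiscreteMeasurableSpace (ZkZk k) := ⟨fun _ => trivial⟩

lemma stepLaw_eq (j : Bool) :
    stepLaw k = (4 : ℝ≥0∞)⁻¹ • (Measure.dirac (ofFactor j 1) + Measure.dirac (ofFactor j (-1))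
      + Measure.dirac (ofFactor (!j) 1) + Measure.dirac (ofFactor (!j) (-1))) := by
  have ha : a k = ofFactor false 1 := rfl
  have hb : b k = ofFactor true 1 := rfl
  rw [stepLaw, ha, hb, ofFactor_inv, ofFactor_inv]
  cases j
  · rfl
  · rw [add_assoc, add_comm, ← add_assoc]
    rfl

lemma integrable_stepLaw (f : ZkZk k → ℝ) : Integrable f (stepLaw k) := by
  have hdirac (s : ZkZk k) : Integrable f (Measure.dirac s) := integrable_dirac (by simp)
  exact ((((hdirac _).add_measure (hdirac _)).add_measure (hdirac _)).add_measure
    (hdirac _)).smul_measure (by simp)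

lemma integral_stepLaw (f : ZkZk k → ℝ) (j : Bool) :
    ∫ s, f s ∂stepLaw k
      = (f (ofFactor j 1) + f (ofFactor j (-1)) + f (ofFactor (!j) 1)
        + f (ofFactor (!j) (-1))) / 4 := by
  have hdirac (s : ZkZk k) : Integrable f (Measure.dirac s) := integrable_dirac (by simp)
  rw [stepLaw_eq j, integral_smul_measure,
    integral_add_measure (((hdirac _).add_measure (hdirac _)).add_measure (hdirac _)) (hdirac _),
    integral_add_measure ((hdirac _).add_measure (hdirac _)) (hdirac _),
    integral_add_measure (hdirac _) (hdirac _)]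
  simp only [integral_dirac, ENNReal.toReal_inv, ENNReal.toReal_ofNat, smul_eq_mul]
  ring

lemma ae_stepLaw_exists_ofFactor : ∀ᵐ s ∂stepLaw k, ∃ i m, s = ofFactor i m := by
  rw [stepLaw_eq false]
  refine Measure.ae_smul_measure ?_ _
  simp only [ae_add_measure_iff, ae_dirac_eq, eventually_pure]
  exact ⟨⟨⟨⟨_, _, rfl⟩, _, _, rfl⟩, _, _, rfl⟩, _, _, rfl⟩

/-- The multiplicative function on normal forms whose value at a syllable of residue `m` is
`w m`. -/
def weight (w : ZMod k → ℝ) (g : ZkZk k) : ℝ := ((normalForm g).map fun l => w (residue l)).prod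

/-- The additive function on normal forms whose value at a syllable of residue `m` is `v m`. -/
def potential (v : ZMod k → ℝ) (g : ZkZk k) : ℝ := ((normalForm g).map fun l => v (residue l)).sum

variable {w v : ZMod k → ℝ} {g : ZkZk k} {L : List (Syllable k)} {j : Bool} {m : ZMod k}

@[simp] lemma weight_one : weight w 1 = 1 := by simp [weight]

@[simp] lemma potential_one : potential v 1 = 0 := by simp [potential]

lemma prod_map_tail (h0 : w 0 = 1) (i : Bool) (m : ZMod k) :
    ((tail i m).map fun l => w (residue l)).prod = w m := by
  unfold tail
  split_ifs with h <;> simp [h, h0]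

lemma sum_map_tail (h0 : v 0 = 0) (i : Bool) (m : ZMod k) :
    ((tail i m).map fun l => v (residue l)).sum = v m := by
  unfold tail
  split_ifs with h <;> simp [h, h0]

lemma weight_of_normalForm_append (h : normalForm g = L ++ [syllable j m]) :
    weight w g = (L.map fun l => w (residue l)).prod * w m := by
  simp [weight, h]

lemma potential_of_normalForm_append (h : normalForm g = L ++ [syllable j m]) :
    potential v g = (L.map fun l => v (residue l)).sum + v m := by
  simp [potential, h]

lemma integral_weight_stepLaw (h0 : w 0 = 1) :
    ∫ s, weight w s ∂stepLaw k = (w 1 + w (-1)) / 2 := by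
  simp only [integral_stepLaw _ true, weight, normalForm_ofFactor, prod_map_tail h0]
  ring

lemma integral_weight_mul (h0 : w 0 = 1) (h : normalForm g = L ++ [syllable j m]) :
    ∫ s, weight w (g * s) ∂stepLaw k = (L.map fun l => w (residue l)).prod
      * (w (m + 1) + w (m - 1) + w m * (w 1 + w (-1))) / 4 := by
  rw [integral_stepLaw _ j]
  simp only [weight, normalForm_mul_same h, normalForm_mul_other h (Bool.not_ne_self j),
    List.map_append, List.prod_append, prod_map_tail h0, ← sub_eq_add_neg]
  simp only [h, List.map_append, List.prod_append, List.map_singleton, List.prod_singleton,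
    syllable_residue]
  ring

lemma integral_potential_stepLaw (h0 : v 0 = 0) :
    ∫ s, potential v s ∂stepLaw k = (v 1 + v (-1)) / 2 := by
  simp only [integral_stepLaw _ true, potential, normalForm_ofFactor, sum_map_tail h0]
  ring

lemma integral_potential_mul (h0 : v 0 = 0) (h : normalForm g = L ++ [syllable j m]) :
    ∫ s, potential v (g * s) ∂stepLaw k = (L.map fun l => v (residue l)).sum
      + (v (m + 1) + v (m - 1) + 2 * v m + v 1 + v (-1)) / 4 := by
  rw [integral_stepLaw _ j]
  simp only [potential, normalForm_mul_same h, normalForm_mul_other h (Bool.not_ne_self j),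
    List.map_append, List.sum_append, sum_map_tail h0, ← sub_eq_add_neg]
  simp only [h, List.map_append, List.sum_append, List.map_singleton, List.sum_singleton,
    syllable_residue]
  ring

lemma weight_inv (hw : ∀ m, w (-m) = w m) (g : ZkZk k) : weight w g⁻¹ = weight w g := by
  simp only [weight, normalForm_inv, List.map_reverse, List.prod_reverse, List.map_map,
    Function.comp_def, syllable_residue, hw]

lemma weight_nonneg (hw : ∀ m, 0 ≤ w m) (g : ZkZk k) : 0 ≤ weight w g :=
  List.prod_nonneg fun y hy => by
    obtain ⟨l, -, rfl⟩ := List.mem_map.1 hy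
    exact hw _

lemma weight_le_pow_len {c : ℝ} (hw : ∀ m, 0 ≤ w m) (hc : ∀ m ≠ 0, w m ≤ c) (g : ZkZk k) :
    weight w g ≤ c ^ len g := by
  refine (List.prod_map_le_prod_map₀ _ (fun _ => c) (fun l _ => hw _)
    fun l hl => hc _ ((reduced_normalForm g).1 l hl)).trans_eq ?_
  simp [len]

lemma abs_sum_map_le {K : ℝ} (hv : ∀ m, |v m| ≤ K) (L : List (Syllable k)) :
    |(L.map fun l => v (residue l)).sum| ≤ L.length * K := by
  induction L with
  | nil => simp
  | cons l L ih =>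
    simp only [List.map_cons, List.sum_cons, List.length_cons, Nat.cast_succ]
    linarith [abs_add_le (v (residue l)) (L.map fun l => v (residue l)).sum, hv (residue l)]

lemma abs_potential_mul_ofFactor_sub_le {K : ℝ} (hv : ∀ m, |v m| ≤ K) (g : ZkZk k) (i : Bool)
    (m : ZMod k) : |potential v (g * ofFactor i m) - potential v g| ≤ 2 * K := by
  obtain ⟨L, A, B, hA, hB, h1, h2⟩ := exists_normalForm_mul g i m
  have hK : 0 ≤ K := (abs_nonneg _).trans (hv 0)
  have hle {C : List (Syllable k)} (hC : C.length ≤ 1) :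
      |(C.map fun l => v (residue l)).sum| ≤ K :=
    (abs_sum_map_le hv C).trans (mul_le_of_le_one_left hK (by exact_mod_cast hC))
  rw [potential, potential, h1, h2, List.map_append, List.map_append, List.sum_append,
    List.sum_append, add_sub_add_left_eq_sub]
  linarith [abs_sub (B.map fun l => v (residue l)).sum (A.map fun l => v (residue l)).sum,
    hle hA, hle hB]

end StepLaw

/-! ### Hitting weights -/

section HittingWeight

variable {k : ℕ}

/-- `w m` is the probability that the walk started at `a ^ m` (or `b ^ m`) ever visits `1`, encoded
by the properties that determine it: harmonicity says that a step inside the current factor changes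
`m` by `±1`, while a step to the other factor has to be undone, which has probability `w 1`. -/
structure IsHittingWeight (w : ZMod k → ℝ) : Prop where
  zero : w 0 = 1
  neg : ∀ m, w (-m) = w m
  pos : ∀ m, 0 < w m
  lt_one : ∀ m ≠ 0, w m < 1
  harmonic : ∀ m ≠ 0, w (m + 1) + w (m - 1) + 2 * w 1 * w m = 4 * w m

/-- The potential associated with `v` has, off `1`, constant mean increment `c` under a step of the
walk. -/
structure IsDriftPotential (v : ZMod k → ℝ) (c : ℝ) : Prop where
  zero : v 0 = 0
  increment : ∀ m ≠ 0, v (m + 1) + v (m - 1) + v 1 + v (-1) = 2 * v m + 4 * c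

/-- The potential associated with `v`, corrected by a multiple of `weight w` that makes its mean
increment equal to `c` at `1` as well. -/
def correctedPotential (w v : ZMod k → ℝ) (c : ℝ) (g : ZkZk k) : ℝ :=
  potential v g + ((v 1 + v (-1)) / 2 - c) / (1 - w 1) * weight w g

lemma sum_laplacian_mul [NeZero k] (f g : ZMod k → ℝ) :
    ∑ m, (f (m + 1) + f (m - 1) - 2 * f m) * g m
      = ∑ m, f m * (g (m + 1) + g (m - 1) - 2 * g m) := by
  have hright : ∑ m, f (m + 1) * g m = ∑ m, f m * g (m - 1) := by
    rw [← Equiv.sum_comp (Equiv.addRight (1 : ZMod k)) fun m => f m * g (m - 1)]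
    simp
  have hleft : ∑ m, f (m - 1) * g m = ∑ m, f m * g (m + 1) := by
    rw [← Equiv.sum_comp (Equiv.subRight (1 : ZMod k)) fun m => f m * g (m + 1)]
    simp
  simp only [add_mul, sub_mul, mul_add, mul_sub, Finset.sum_add_distrib, Finset.sum_sub_distrib,
    hright, hleft]
  rw [add_comm (∑ m, f m * g (m - 1)), Finset.sum_congr rfl fun m _ => mul_left_comm (f m) 2 (g m)]
  simp only [mul_assoc]

lemma exists_abs_le [NeZero k] (v : ZMod k → ℝ) : ∃ K, ∀ m, |v m| ≤ K :=
  ⟨_, fun m => Finset.single_le_sum (f := fun m => |v m|) (fun _ _ => abs_nonneg _)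
    (Finset.mem_univ m)⟩

namespace IsHittingWeight

variable {w v : ZMod k → ℝ} {c : ℝ} (hw : IsHittingWeight w)

include hw

lemma le_one (m : ZMod k) : w m ≤ 1 := by
  by_cases hm : m = 0
  · exact (hm ▸ hw.zero).le
  · exact (hw.lt_one m hm).le

lemma weight_nonneg (g : ZkZk k) : 0 ≤ weight w g :=
  FreeProductWalk.weight_nonneg (fun m => (hw.pos m).le) g

lemma weight_le_one (g : ZkZk k) : weight w g ≤ 1 :=
  (weight_le_pow_len (fun m => (hw.pos m).le) (fun m _ => hw.le_one m) g).trans_eq (one_pow _)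

lemma integral_weight_mul {g : ZkZk k} (hg : g ≠ 1) :
    ∫ s, weight w (g * s) ∂stepLaw k = weight w g := by
  obtain ⟨L, j, m, hm, hL⟩ := (eq_one_or_exists_last g).resolve_left hg
  rw [FreeProductWalk.integral_weight_mul hw.zero hL, weight_of_normalForm_append hL, hw.neg]
  linear_combination (L.map fun l => w (residue l)).prod / 4 * hw.harmonic m hm

lemma laplacian (m : ZMod k) :
    w (m + 1) + w (m - 1) - 2 * w m = 2 * (1 - w 1) * (w m - if m = 0 then 2 else 0) := by
  split_ifs with hm
  · subst hm
    rw [zero_add, zero_sub, hw.neg, hw.zero]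
    ring
  · linear_combination hw.harmonic m hm

lemma exists_abs_correctedPotential_sub_potential_le (v : ZMod k → ℝ) (c : ℝ) :
    ∃ K, ∀ g, |correctedPotential w v c g - potential v g| ≤ K := by
  refine ⟨|((v 1 + v (-1)) / 2 - c) / (1 - w 1)|, fun g => ?_⟩
  rw [correctedPotential, add_sub_cancel_left, abs_mul, abs_of_nonneg (hw.weight_nonneg g)]
  exact mul_le_of_le_one_right (abs_nonneg _) (hw.weight_le_one g)

variable [Fact (1 < k)]

lemma one_lt_one : w 1 < 1 := hw.lt_one 1 one_ne_zero

/-- Sum the Laplacian of `w` over the cyclic group. -/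
lemma sum_eq_two : ∑ m, w m = 2 := by
  have h := sum_laplacian_mul w 1
  simp only [hw.laplacian, Pi.one_apply, mul_one, ← Finset.mul_sum, Finset.sum_sub_distrib,
    Finset.sum_ite_eq', Finset.mem_univ, if_true] at h
  norm_num [sub_ne_zero.2 hw.one_lt_one.ne', sub_eq_zero] at h
  exact h

/-- Sum `w` against the Laplacian of `v` by parts. -/
lemma sum_mul_eq (hv : IsDriftPotential v c) : (1 - w 1) * ∑ m, w m * v m = 2 * c := by
  have h := sum_laplacian_mul w v
  have hv' (m : ZMod k) : v (m + 1) + v (m - 1) - 2 * v m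
      = 4 * c - v 1 - v (-1) + if m = 0 then 2 * (v 1 + v (-1)) - 4 * c else 0 := by
    split_ifs with hm
    · subst hm
      rw [zero_add, zero_sub, hv.zero]
      ring
    · linear_combination hv.increment m hm
  simp only [hw.laplacian, hv', mul_sub, sub_mul, mul_add, ite_mul, mul_ite, zero_mul, mul_zero,
    Finset.sum_sub_distrib, Finset.sum_add_distrib, Finset.sum_ite_eq', Finset.mem_univ, if_true,
    hv.zero, hw.zero, ← Finset.sum_mul, hw.sum_eq_two, mul_assoc, ← Finset.mul_sum] at h
  linarith

lemma tendsto_weight_zero {g : ℕ → ZkZk k}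
    (hg : Tendsto (fun n => len (g n)) atTop atTop) :
    Tendsto (fun n => weight w (g n)) atTop (𝓝 0) := by
  obtain ⟨m₀, hm₀, hmax⟩ := Finset.exists_max_image (Finset.univ.filter fun m : ZMod k => m ≠ 0) w
    ⟨1, by simp⟩
  have hlt : w m₀ < 1 := hw.lt_one _ (by simpa using hm₀)
  exact squeeze_zero (fun n => hw.weight_nonneg _)
    (fun n => weight_le_pow_len (fun m => (hw.pos m).le) (fun m hm => hmax m (by simpa using hm)) _)
    ((tendsto_pow_atTop_nhds_zero_of_lt_one (hw.pos m₀).le hlt).comp hg)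

lemma integral_correctedPotential_sub (hv : IsDriftPotential v c) (g : ZkZk k) :
    ∫ s, (correctedPotential w v c (g * s) - correctedPotential w v c g) ∂stepLaw k = c := by
  rw [integral_sub (integrable_stepLaw _) (integrable_stepLaw _), integral_const, probReal_univ,
    one_smul]
  simp only [correctedPotential]
  rw [integral_add (integrable_stepLaw _) (integrable_stepLaw _), integral_const_mul]
  by_cases hg : g = 1
  · subst hg
    have : 1 - w 1 ≠ 0 := sub_ne_zero.2 hw.one_lt_one.ne'
    simp only [one_mul, integral_potential_stepLaw hv.zero, integral_weight_stepLaw hw.zero, hw.neg,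
      weight_one, potential_one]
    field_simp
    ring
  · obtain ⟨L, j, m, hm, hL⟩ := (eq_one_or_exists_last g).resolve_left hg
    rw [hw.integral_weight_mul hg, integral_potential_mul hv.zero hL,
      potential_of_normalForm_append hL]
    linear_combination hv.increment m hm / 4

lemma ae_tendsto_potential_div (hv : IsDriftPotential v c) :
    ∀ᵐ x ∂incrementLaw (stepLaw k),
      Tendsto (fun n : ℕ => potential v (walk x n) / n) atTop (𝓝 c) := by
  obtain ⟨K, hK⟩ := exists_abs_le v
  obtain ⟨C, hC⟩ := hw.exists_abs_correctedPotential_sub_potential_le v c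
  have hstep (g : ZkZk k) : ∀ᵐ s ∂stepLaw k,
      |correctedPotential w v c (g * s) - correctedPotential w v c g| ≤ C + 2 * K + C := by
    filter_upwards [ae_stepLaw_exists_ofFactor] with s ⟨i, m, hs⟩
    have hpot := abs_potential_mul_ofFactor_sub_le hK g i m
    rw [← hs] at hpot
    have h1 := abs_le.1 hpot
    have h2 := abs_le.1 (hC g)
    have h3 := abs_le.1 (hC (g * s))
    exact abs_le.2 ⟨by linarith, by linarith⟩
  filter_upwards [ae_tendsto_walk_div hstep (hw.integral_correctedPotential_sub hv)] with x hx
  have hcorr : Tendsto (fun n : ℕ =>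
      (correctedPotential w v c (walk x n) - potential v (walk x n)) / n) atTop (𝓝 0) :=
    squeeze_zero_norm (fun n => by
      rw [norm_div, Real.norm_natCast]
      exact div_le_div_of_nonneg_right (hC _) n.cast_nonneg)
      (tendsto_const_div_atTop_nhds_zero_nat C)
  have hsub := hx.sub hcorr
  rw [sub_zero] at hsub
  exact hsub.congr fun n => by rw [← sub_div, sub_sub_cancel]

lemma ae_tendsto_len (hv : IsDriftPotential v c) (hc : 0 < c) :
    ∀ᵐ x ∂incrementLaw (stepLaw k), Tendsto (fun n => len (walk x n)) atTop atTop := by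
  obtain ⟨K, hK⟩ := exists_abs_le v
  have hle (g : ZkZk k) : potential v g ≤ len g * K :=
    (le_abs_self _).trans (abs_sum_map_le hK _)
  filter_upwards [hw.ae_tendsto_potential_div hv] with x hx
  have hpot : Tendsto (fun n => potential v (walk x n)) atTop atTop := by
    refine (hx.pos_mul_atTop hc tendsto_natCast_atTop_atTop).congr' ?_
    filter_upwards [eventually_ne_atTop 0] with n hn
    field_simp
  have hlenK := tendsto_atTop_mono (fun n => hle (walk x n)) hpot
  have hK0 : 0 < K + 1 := by linarith [(abs_nonneg _).trans (hK 0)]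
  refine tendsto_natCast_atTop_iff.1 ((tendsto_mul_const_atTop_of_pos hK0).1
    (tendsto_atTop_mono (fun n => ?_) hlenK))
  exact mul_le_mul_of_nonneg_left (lt_add_one K).le (Nat.cast_nonneg _)

end IsHittingWeight

end HittingWeight

/-! ### The limit word -/

section LimitWord

variable {k : ℕ}

/-- A path started at `1`, each step of which multiplies by an element of one of the factors. -/
structure IsPath (X : ℕ → ZkZk k) : Prop where
  zero : X 0 = 1
  step : ∀ n, ∃ i m, X (n + 1) = X n * ofFactor i m

lemma ae_isPath_walk : ∀ᵐ x ∂incrementLaw (stepLaw k), IsPath (walk x) := by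
  filter_upwards [ae_incrementLaw_forall ae_stepLaw_exists_ofFactor] with x hx
  refine ⟨rfl, fun n => ?_⟩
  obtain ⟨i, m, hxn⟩ := hx n
  exact ⟨i, m, by rw [walk, hxn]⟩

lemma exists_last_visit {ℓ : ℕ → ℕ} (h0 : ℓ 0 = 0) (hstep : ∀ n, ℓ (n + 1) ≤ ℓ n + 1)
    (hℓ : Tendsto ℓ atTop atTop) (m : ℕ) : ∃ N, ℓ N = m ∧ ∀ n > N, m < ℓ n := by
  obtain ⟨N₀, hN₀⟩ := eventually_atTop.1 (hℓ.eventually_gt_atTop m)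
  have hle := Nat.findGreatest_spec (P := fun n => ℓ n ≤ m) (Nat.zero_le N₀) (by simp [h0])
  set N := Nat.findGreatest (fun n => ℓ n ≤ m) N₀
  have hlt (n : ℕ) (hn : n > N) : m < ℓ n := by
    rcases le_total N₀ n with h | h
    · exact hN₀ n h
    · exact not_le.1 (Nat.findGreatest_is_greatest (P := fun n => ℓ n ≤ m) hn h)
  have := hlt (N + 1) N.lt_succ_self
  exact ⟨N, by have := hstep N; omega, hlt⟩

namespace IsPath

variable {X : ℕ → ZkZk k} (hX : IsPath X)

include hX

lemma len_succ_le (n : ℕ) : len (X (n + 1)) ≤ len (X n) + 1 := by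
  obtain ⟨i, m, h⟩ := hX.step n
  exact h ▸ len_mul_ofFactor_le _ _ _

lemma len_zero : len (X 0) = 0 := by rw [hX.zero, len_one]

lemma len_le (n : ℕ) : len (X n) ≤ n := by
  induction n with
  | zero => exact hX.len_zero.le
  | succ n ih => exact (hX.len_succ_le n).trans (Nat.succ_le_succ ih)

lemma take_normalForm_eq {N m : ℕ} (hN : ∀ n > N, m < len (X n)) {n : ℕ} (hn : N ≤ n) :
    (normalForm (X n)).take m = (normalForm (X N)).take m := by
  induction n, hn using Nat.le_induction with
  | base => rfl
  | succ n hn ih =>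
    obtain ⟨i, e, h⟩ := hX.step n
    have hback : X n = X (n + 1) * ofFactor i (-e) := by
      rw [h, mul_assoc, ofFactor_mul_ofFactor, add_neg_cancel, ofFactor_zero, mul_one]
    rw [← ih, hback, take_normalForm_mul_ofFactor (hN _ (Nat.lt_succ_of_le hn))]

lemma exists_eventually_getElem? (hlen : Tendsto (fun n => len (X n)) atTop atTop) (m : ℕ) :
    ∃ u : Letter k, ∀ᶠ n in atTop, (normalForm (X n))[m]? = some u.1 := by
  obtain ⟨N, hNm, hN⟩ := exists_last_visit hX.len_zero hX.len_succ_le hlen (m + 1)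
  have hm : m < (normalForm (X N)).length := by rw [← len, hNm]; exact m.lt_succ_self
  refine ⟨⟨(normalForm (X N))[m], (reduced_normalForm _).1 _ (List.getElem_mem hm)⟩, ?_⟩
  filter_upwards [eventually_ge_atTop N] with n hn
  rw [← List.getElem?_take_of_lt m.lt_succ_self, hX.take_normalForm_eq hN hn,
    List.getElem?_take_of_lt m.lt_succ_self, List.getElem?_eq_getElem hm]

end IsPath

/-- The first `m` syllables of an infinite word. -/
def Boundary.take (w : Boundary k) (m : ℕ) : List (Syllable k) :=
  List.ofFn fun i : Fin m => (w.1 i).1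

lemma ConvergesTo.eventually_take_eq {g : ℕ → ZkZk k} {w : Boundary k} (h : ConvergesTo g w)
    (m : ℕ) : ∀ᶠ n in atTop, (normalForm (g n)).take m = w.take m := by
  have hletters : ∀ᶠ n in atTop, ∀ i ∈ Finset.range m, (normalForm (g n))[i]? = some (w.1 i).1 :=
    (Filter.eventually_all_finset _).2 fun i _ => h i
  filter_upwards [hletters] with n hn
  refine List.ext_getElem? fun i => ?_
  rw [List.getElem?_take, Boundary.take, List.getElem?_ofFn]
  by_cases hi : i < m
  · simp [hi, hn i (Finset.mem_range.2 hi)]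
  · simp [hi]

lemma ConvergesTo.normalForm_eq_take {X : ℕ → ZkZk k} {w : Boundary k} (h : ConvergesTo X w)
    (hX : IsPath X) {N m : ℕ} (hNm : len (X N) = m) (hN : ∀ n > N, m < len (X n)) :
    normalForm (X N) = w.take m := by
  obtain ⟨n, htake, hn⟩ := ((h.eventually_take_eq m).and (eventually_ge_atTop N)).exists
  rw [← htake, hX.take_normalForm_eq hN hn, List.take_of_length_le hNm.le]

lemma exists_convergesTo_iff {g : ℕ → ZkZk k} :
    (∃ w, ConvergesTo g w) ↔
      ∀ m : ℕ, ∃ u : Letter k, ∀ᶠ n in atTop, (normalForm (g n))[m]? = some u.1 := by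
  refine ⟨fun ⟨w, hw⟩ m => ⟨w.1 m, hw m⟩, fun h => ?_⟩
  choose u hu using h
  refine ⟨⟨u, fun m => ?_⟩, hu⟩
  obtain ⟨n, hn, hn'⟩ := ((hu m).and (hu (m + 1))).exists
  obtain ⟨_, hm⟩ := List.getElem?_eq_some_iff.1 hn
  obtain ⟨hlt, hm'⟩ := List.getElem?_eq_some_iff.1 hn'
  have hchain := List.isChain_iff_getElem.1 (reduced_normalForm (g n)).2 m hlt
  rwa [hm, hm'] at hchain

instance : Countable (Letter k) := inferInstanceAs (Countable {s : Syllable k // s.2 ≠ 1})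

instance : DiscreteMeasurableSpace (Letter k) := ⟨fun _ => trivial⟩

lemma Boundary.measurable_apply (m : ℕ) : Measurable fun w : Boundary k => w.1 m :=
  (measurable_pi_apply m).comp measurable_subtype_coe

lemma measurableSet_eventually_getElem? (m : ℕ) (u : Letter k) :
    MeasurableSet {x : ℕ → ZkZk k | ∀ᶠ n in atTop, (normalForm (walk x n))[m]? = some u.1} := by
  simp only [eventually_atTop, Set.ofPred_exists, Set.ofPred_forall]
  refine .iUnion fun N => .iInter fun n => .iInter fun _ => ?_
  exact (MeasurableSet.of_discrete (s := {g : ZkZk k | (normalForm g)[m]? = some u.1})).preimage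
    (measurable_walk n)

variable [Fact (1 < k)]

instance : Nonempty (Boundary k) :=
  ⟨⟨fun n => ⟨syllable (Nat.bodd n) 1, syllable_snd_ne_one.2 one_ne_zero⟩, fun n => by
    simp [Letter.factor]⟩⟩

/-- The infinite word to which a sequence of group elements converges (an unspecified word if the
sequence does not converge). -/
def limitWord (g : ℕ → ZkZk k) : Boundary k := Classical.epsilon (ConvergesTo g)

lemma convergesTo_limitWord {g : ℕ → ZkZk k} (h : ∃ w, ConvergesTo g w) :
    ConvergesTo g (limitWord g) := Classical.epsilon_spec h

lemma IsPath.convergesTo_limitWord {X : ℕ → ZkZk k} (hX : IsPath X)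
    (hlen : Tendsto (fun n => len (X n)) atTop atTop) : ConvergesTo X (limitWord X) :=
  FreeProductWalk.convergesTo_limitWord
    (exists_convergesTo_iff.2 (hX.exists_eventually_getElem? hlen))

lemma measurable_limitWord_walk : Measurable fun x : ℕ → ZkZk k => limitWord (walk x) := by
  refine Measurable.subtype_mk (p := fun w : ℕ → Letter k => ∀ n, (w n).factor ≠ (w (n + 1)).factor)
    (f := fun x => (limitWord (walk x)).1) (h := fun x => (limitWord (walk x)).2)
    (measurable_pi_lambda _ fun m => measurable_to_countable' fun u => ?_)
  set C : Set (ℕ → ZkZk k) := {x | ∃ w, ConvergesTo (walk x) w} with hC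
  have hCm : MeasurableSet C := by
    simp only [hC, exists_convergesTo_iff, Set.ofPred_forall, Set.ofPred_exists]
    exact .iInter fun m => .iUnion fun u => measurableSet_eventually_getElem? m u
  have hoff (x : ℕ → ZkZk k) (hx : x ∉ C) :
      limitWord (walk x) = Classical.epsilon fun _ : Boundary k => False :=
    congrArg Classical.epsilon (funext fun w => eq_false fun hw => hx ⟨w, hw⟩)
  have hset : (fun x => (limitWord (walk x)).1 m) ⁻¹' {u} =
      C.ite {x | ∀ᶠ n in atTop, (normalForm (walk x n))[m]? = some u.1}
        {_x | (Classical.epsilon fun _ : Boundary k => False).1 m = u} := by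
    ext x
    by_cases hx : x ∈ C
    · have hlim := convergesTo_limitWord hx m
      simp only [Set.mem_preimage, Set.mem_singleton_iff, Set.ite, Set.mem_union, Set.mem_inter_iff,
        Set.mem_sdiff, hx, and_true, not_true, and_false, or_false, Set.mem_ofPred_eq]
      refine ⟨fun h => h ▸ hlim, fun h => ?_⟩
      obtain ⟨n, hn, hn'⟩ := (hlim.and h).exists
      exact Subtype.ext (Option.some_injective _ (hn.symm.trans hn'))
    · simp [Set.ite, hx, hoff x hx]
  rw [hset]
  exact hCm.ite (measurableSet_eventually_getElem? m u) (.const _)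

end LimitWord

/-! ### The harmonic measure -/

section HarmonicMeasure

variable {k : ℕ} {w : ZMod k → ℝ} {g : ZkZk k} {i c : Bool} {m : ZMod k}

lemma startsIn_ofFactor (hm : m ≠ 0) : StartsIn c (ofFactor i m) ↔ i = c := by
  simp [StartsIn, tail_of_ne hm]

lemma not_startsIn_one : ¬StartsIn c (1 : ZkZk k) := by simp [StartsIn]

lemma startsIn_mul_ofFactor (hg : g ≠ 1) (hgm : g * ofFactor i m ≠ 1) :
    StartsIn c (g * ofFactor i m) ↔ StartsIn c g := by
  obtain ⟨L, j, e, -, hL⟩ := (eq_one_or_exists_last g).resolve_left hg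
  obtain rfl | hij := eq_or_ne i j
  · have hmul := normalForm_mul_same hL m
    rw [StartsIn, StartsIn, hL, hmul]
    rcases L with _ | ⟨l, L⟩
    · have hne : e + m ≠ 0 := fun h0 => by
        rw [h0, tail_zero, List.append_nil] at hmul
        exact hgm (normalForm_eq_nil.1 hmul)
      simp [tail_of_ne hne]
    · simp
  · rw [StartsIn, StartsIn, normalForm_mul_other hL hij, hL]
    rcases L with _ | ⟨l, L⟩ <;> simp

open Classical in
/-- The probability that the limit of the walk started at `g` starts in the factor `c`, for the
hitting weight `w`: the walk visits `1` with probability `weight w g`, and then, by symmetry, starts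
in either factor with probability `1 / 2`; otherwise its first letter stays in the factor of the
first letter of `g`. -/
def startProb (w : ZMod k → ℝ) (c : Bool) (g : ZkZk k) : ℝ :=
  if StartsIn c g then 1 - weight w g / 2 else weight w g / 2

/-- At `g * ofFactor i m = 1` both branches of `startProb` are equal to `1 / 2`. -/
lemma startProb_mul_ofFactor [Decidable (StartsIn c g)] (hg : g ≠ 1) :
    startProb w c (g * ofFactor i m) =
      if StartsIn c g then 1 - weight w (g * ofFactor i m) / 2
      else weight w (g * ofFactor i m) / 2 := by
  by_cases hgm : g * ofFactor i m = 1
  · rw [hgm, startProb, weight_one]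
    split_ifs <;> norm_num
  · simp only [startProb, startsIn_mul_ofFactor hg hgm]

/-- The nonzero residues modulo `k`: the possible exponents of a letter. -/
abbrev NonzeroResidue (k : ℕ) : Type := {m : ZMod k // m ≠ 0}

/-- The letter `a ^ m` (for `i = false`) or `b ^ m` (for `i = true`). -/
def letter (i : Bool) (m : NonzeroResidue k) : Letter k := ⟨syllable i m, m.2⟩

/-- The exponent of a letter, as a nonzero residue modulo `k`. -/
def Letter.residue (u : Letter k) : NonzeroResidue k := ⟨FreeProductWalk.residue u.1, u.2⟩

@[simp] lemma factor_letter (i : Bool) (m : NonzeroResidue k) : (letter i m).factor = i := rfl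

@[simp] lemma residue_letter (i : Bool) (m : NonzeroResidue k) : (letter i m).residue = m := rfl

@[simp] lemma letter_factor_residue (u : Letter k) : letter u.factor u.residue = u := rfl

lemma finsum_letter (f : NonzeroResidue k → ℝ) :
    ∑ᶠ u : Letter k, f u.residue = ∑ᶠ p : Bool × NonzeroResidue k, f p.2 :=
  (finsum_eq_of_bijective (fun p : Bool × NonzeroResidue k => letter p.1 p.2)
    ⟨fun _ _ h => Prod.ext (congrArg Letter.factor h) (congrArg Letter.residue h),
      fun u => ⟨(u.factor, u.residue), letter_factor_residue u⟩⟩ fun _ => rfl).symm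

lemma finsum_letter_factor_ne (f : NonzeroResidue k → ℝ) (c : Bool) :
    ∑ᶠ u : {u : Letter k // u.factor ≠ c}, f u.1.residue = ∑ᶠ m, f m :=
  (finsum_eq_of_bijective
    (fun m => (⟨letter (!c) m, by simp⟩ : {u : Letter k // u.factor ≠ c}))
    ⟨fun _ _ h => congrArg (fun u : {u : Letter k // u.factor ≠ c} => u.1.residue) h,
      fun u => ⟨u.1.residue, Subtype.ext
        (show letter (!c) u.1.residue = u.1 from Bool.eq_not_of_ne u.2 ▸ rfl)⟩⟩ fun _ => rfl).symm

lemma Boundary.factor_eq_xor (ξ : Boundary k) (n : ℕ) :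
    (ξ.1 n).factor = ((ξ.1 0).factor ^^ n.bodd) := by
  induction n with
  | zero => simp
  | succ n ih => rw [Bool.eq_not_of_ne (ξ.2 n).symm, ih, Nat.bodd_succ, Bool.xor_not]

lemma Boundary.forall_residue_eq_iff (ξ : Boundary k) {n : ℕ} (e : Fin n → NonzeroResidue k) :
    (∀ i : Fin n, (ξ.1 i).residue = e i) ↔
      ∃ c : Bool, ∀ i : Fin n, ξ.1 i = letter (c ^^ (i : ℕ).bodd) (e i) := by
  refine ⟨fun h => ⟨(ξ.1 0).factor, fun i => ?_⟩, fun ⟨c, h⟩ i => by rw [h i, residue_letter]⟩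
  rw [← ξ.factor_eq_xor, ← h i, letter_factor_residue]

lemma Boundary.measurableSet_take_eq (n : ℕ) (L : List (Syllable k)) :
    MeasurableSet {w : Boundary k | w.take n = L} :=
  (MeasurableSet.of_discrete
    (s := {u : Fin n → Letter k | List.ofFn (fun i => (u i).1) = L})).preimage
    (measurable_pi_lambda _ fun i : Fin n => Boundary.measurable_apply i)

namespace IsHittingWeight

variable (hw : IsHittingWeight w)

include hw

lemma startProb_mem_Icc (c : Bool) (g : ZkZk k) : startProb w c g ∈ Set.Icc 0 1 := by
  have h0 := hw.weight_nonneg g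
  have h1 := hw.weight_le_one g
  unfold startProb
  split_ifs <;> constructor <;> linarith

variable [Fact (1 < k)]

lemma integral_startProb_mul (c : Bool) (g : ZkZk k) :
    ∫ s, startProb w c (g * s) ∂stepLaw k = startProb w c g := by
  classical
  by_cases hg : g = 1
  · subst hg
    have hneg : (-1 : ZMod k) ≠ 0 := neg_ne_zero.2 one_ne_zero
    simp only [one_mul, integral_stepLaw _ c, startProb, startsIn_ofFactor one_ne_zero,
      startsIn_ofFactor hneg, not_startsIn_one, if_true, if_false, weight_one, Bool.not_eq_self]
    simp only [weight, normalForm_ofFactor, prod_map_tail hw.zero, hw.neg]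
    ring
  · have hG := hw.integral_weight_mul hg
    rw [integral_stepLaw _ c] at hG ⊢
    simp only [startProb_mul_ofFactor hg]
    rw [startProb]
    split_ifs <;> linarith

lemma tendsto_startProb {X : ℕ → ZkZk k} {ξ : Boundary k} (hX : ConvergesTo X ξ)
    (hlen : Tendsto (fun n => len (X n)) atTop atTop) {L : List (Syllable k)} {j : Bool}
    (hL : normalForm g = L ++ [syllable j m]) :
    Tendsto (fun n => startProb w (!j) (g⁻¹ * X n)) atTop
      (𝓝 ({ξ : Boundary k | ξ.take (len g) = normalForm g}.indicator 1 ξ)) := by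
  have hweight : Tendsto (fun n => weight w (g⁻¹ * X n) / 2) atTop (𝓝 0) := by
    rw [← zero_div (2 : ℝ)]
    refine (hw.tendsto_weight_zero (tendsto_atTop.2 fun N => ?_)).div_const 2
    filter_upwards [hlen.eventually_ge_atTop (len g + N)] with n hn
    have hle := len_mul_le g (g⁻¹ * X n)
    rw [mul_inv_cancel_left] at hle
    omega
  have hstarts : ∀ᶠ n in atTop,
      StartsIn (!j) (g⁻¹ * X n) ↔ ξ.take (len g) = normalForm g := by
    filter_upwards [hX.eventually_take_eq (len g), hlen.eventually_gt_atTop (len g)] with n htake hn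
    rw [startsIn_inv_mul_iff hL, List.prefix_iff_eq_take, ← len, htake, and_iff_left hn, eq_comm]
  by_cases hξ : ξ.take (len g) = normalForm g
  · rw [Set.indicator_of_mem (by exact hξ), Pi.one_apply, ← sub_zero (1 : ℝ)]
    refine (hweight.const_sub 1).congr' ?_
    filter_upwards [hstarts] with n hn
    rw [startProb, if_pos (hn.2 hξ)]
  · rw [Set.indicator_of_notMem (by exact hξ)]
    refine hweight.congr' ?_
    filter_upwards [hstarts] with n hn
    rw [startProb, if_neg (hn.not.2 hξ)]

variable (hlen : ∀ᵐ x ∂incrementLaw (stepLaw k), Tendsto (fun n => len (walk x n)) atTop atTop)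

include hlen

lemma measure_limitWord_take_eq (hg : g ≠ 1) :
    incrementLaw (stepLaw k) {x | (limitWord (walk x)).take (len g) = normalForm g}
      = ENNReal.ofReal (weight w g / 2) := by
  obtain ⟨L, j, m, -, hL⟩ := (eq_one_or_exists_last g).resolve_left hg
  have hone : startProb w (!j) (g⁻¹ * 1) = weight w g / 2 := by
    have hns : ¬StartsIn (!j) g⁻¹ := by
      simp [StartsIn, normalForm_inv, hL]
    rw [mul_one, startProb, if_neg hns, weight_inv hw.neg]
  rw [← hone]
  refine measure_eq_of_harmonic (f := fun h => startProb w (!j) (g⁻¹ * h)) (fun h => ?_)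
    (fun h => hw.startProb_mem_Icc _ _)
    (measurable_limitWord_walk (Boundary.measurableSet_take_eq _ _)) ?_
  · simp only [← mul_assoc, hw.integral_startProb_mul]
  · filter_upwards [ae_isPath_walk, hlen] with x hx hxlen
    exact hw.tendsto_startProb (hx.convergesTo_limitWord hxlen) hxlen hL

lemma measure_limitWord_cylinder {n : ℕ} (u : Fin (n + 1) → Letter k)
    (hu : ∀ i : Fin n, (u i.castSucc).factor ≠ (u i.succ).factor) :
    incrementLaw (stepLaw k) {x | ∀ i : Fin (n + 1), (limitWord (walk x)).1 i = u i}
      = ENNReal.ofReal ((∏ i, w (u i).residue) / 2) := by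
  set L : List (Syllable k) := List.ofFn fun i => (u i).1 with hL
  have hred : Reduced L := by
    refine ⟨fun l hl => ?_, List.isChain_iff_getElem.2 fun i hi => ?_⟩
    · obtain ⟨i, rfl⟩ := (List.mem_ofFn' _ _).1 hl
      exact (u i).2
    · simp only [hL, List.length_ofFn] at hi
      simp only [hL, List.getElem_ofFn]
      exact hu ⟨i, by omega⟩
  have hnf := normalForm_listProd hred
  have hlenL : len (listProd L) = n + 1 := by rw [len, hnf, hL, List.length_ofFn]
  have hne : listProd L ≠ 1 := fun h0 => by simp [h0] at hlenL
  have hweight : weight w (listProd L) = ∏ i, w (u i).residue := by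
    rw [weight, hnf, hL, List.map_ofFn, List.prod_ofFn]
    rfl
  rw [← hweight, ← hw.measure_limitWord_take_eq hlen hne, hlenL, hnf]
  simp only [Boundary.take, hL, List.ofFn_injective.eq_iff, funext_iff,
    ← Subtype.val_injective.eq_iff (α := Letter k)]

end IsHittingWeight

variable [Fact (1 < k)]

lemma isHarmonicMeasure_map_limitWord
    (hlen : ∀ᵐ x ∂incrementLaw (stepLaw k), Tendsto (fun n => len (walk x n)) atTop atTop) :
    IsHarmonicMeasure (stepLaw k) ((incrementLaw (stepLaw k)).map fun x => limitWord (walk x)) := by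
  refine ⟨_, measurable_limitWord_walk.aemeasurable, ?_, rfl⟩
  filter_upwards [ae_isPath_walk, hlen] with x hx hxlen
  exact hx.convergesTo_limitWord hxlen

lemma measurable_residue_limitWord (n : ℕ) :
    Measurable fun x : ℕ → ZkZk k => ((limitWord (walk x)).1 n).residue :=
  (Measurable.of_discrete (f := Letter.residue (k := k))).comp
    ((Boundary.measurable_apply n).comp measurable_limitWord_walk)

/-- The law of the residue of a letter of the limit word, for the hitting weight `w`. -/
def residueLaw (w : ZMod k → ℝ) : Measure (NonzeroResidue k) :=
  ∑ m : NonzeroResidue k, ENNReal.ofReal (w m) • Measure.dirac m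

lemma residueLaw_singleton (w : ZMod k → ℝ) (m : NonzeroResidue k) :
    residueLaw w {m} = ENNReal.ofReal (w m) := by
  simp [residueLaw, Measure.finsetSum_apply, Set.indicator_apply]

lemma integrable_residueLaw (w : ZMod k → ℝ) (f : NonzeroResidue k → ℝ) :
    Integrable f (residueLaw w) :=
  integrable_finsetSum_measure.2 fun _ _ =>
    (integrable_dirac (by simp)).smul_measure ENNReal.ofReal_ne_top

namespace IsHittingWeight

variable (hw : IsHittingWeight w)

include hw

lemma sum_mul_nonzero (v : ZMod k → ℝ) :
    ∑ m : NonzeroResidue k, w m * v m = ∑ m, w m * v m - v 0 := by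
  rw [Fintype.sum_eq_add_sum_subtype_ne _ (0 : ZMod k), hw.zero, one_mul, add_sub_cancel_left]

lemma sum_nonzero : ∑ m : NonzeroResidue k, w m = 1 := by
  have h := hw.sum_mul_nonzero 1
  simp only [Pi.one_apply, mul_one, hw.sum_eq_two] at h
  linarith

lemma transition_eq {u v : Letter k} (huv : u.factor ≠ v.factor) :
    transition (fun s : Letter k => w s.residue / 2) u v = w v.residue := by
  rw [transition, if_neg huv.symm,
    finsum_letter_factor_ne (fun m : NonzeroResidue k => w m / 2) u.factor,
    finsum_eq_sum_of_fintype, ← Finset.sum_div, hw.sum_nonzero]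
  ring

lemma isProbabilityMeasure_residueLaw : IsProbabilityMeasure (residueLaw w) := by
  constructor
  simp only [residueLaw, Measure.finsetSum_apply, Measure.smul_apply, measure_univ, smul_eq_mul,
    mul_one]
  rw [← ENNReal.ofReal_sum_of_nonneg fun (m : NonzeroResidue k) _ => (hw.pos m).le,
    hw.sum_nonzero, ENNReal.ofReal_one]

lemma integral_residueLaw (v : ZMod k → ℝ) (h0 : v 0 = 0) :
    ∫ m, v m ∂residueLaw w = ∑ m, w m * v m := by
  rw [residueLaw, integral_finsetSum_measure fun m _ =>
    (integrable_dirac (by simp)).smul_measure ENNReal.ofReal_ne_top]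
  simp only [integral_smul_measure, integral_dirac, ENNReal.toReal_ofReal (hw.pos _).le,
    smul_eq_mul]
  rw [hw.sum_mul_nonzero, h0, sub_zero]

variable (hlen : ∀ᵐ x ∂incrementLaw (stepLaw k), Tendsto (fun n => len (walk x n)) atTop atTop)

include hlen

lemma isMarkovianMultiplicative : IsMarkovianMultiplicative (fun s : Letter k => w s.residue / 2)
    ((incrementLaw (stepLaw k)).map fun x => limitWord (walk x)) where
  pos s := half_pos (hw.pos _)
  sum_eq_one := by
    rw [finsum_letter fun m : NonzeroResidue k => w m / 2, finsum_eq_sum_of_fintype,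
      Fintype.sum_prod_type]
    simp only [← Finset.sum_div, hw.sum_nonzero]
    norm_num
  isProbabilityMeasure := Measure.isProbabilityMeasure_map measurable_limitWord_walk.aemeasurable
  cylinder n u := by
    have hmeas : MeasurableSet {ξ : Boundary k | ∀ i : Fin (n + 1), ξ.1 i = u i} := by
      simp only [Set.ofPred_forall]
      exact .iInter fun i => Boundary.measurable_apply i (.of_discrete (s := {u i}))
    rw [Measure.map_apply measurable_limitWord_walk hmeas]
    by_cases hu : ∀ i : Fin n, (u i.castSucc).factor ≠ (u i.succ).factor
    · rw [Finset.prod_congr rfl fun i _ => hw.transition_eq (hu i), div_mul_eq_mul_div,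
        ← Fin.prod_univ_succ fun i => w (u i).residue]
      exact hw.measure_limitWord_cylinder hlen u hu
    · push Not at hu
      obtain ⟨i, hi⟩ := hu
      have hempty : {ξ : Boundary k | ∀ i : Fin (n + 1), ξ.1 i = u i} = ∅ :=
        Set.eq_empty_of_forall_notMem fun ξ hξ =>
          ξ.2 i (by rw [← Fin.val_castSucc, hξ, hi, ← hξ, Fin.val_succ, Fin.val_castSucc])
      have hzero : transition (fun s : Letter k => w s.residue / 2) (u i.castSucc) (u i.succ) = 0 :=
        if_pos hi.symm
      rw [hempty, Set.preimage_empty, measure_empty,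
        Finset.prod_eq_zero (Finset.mem_univ i) hzero, mul_zero, ENNReal.ofReal_zero]

lemma map_residue_limitWord_fin (n : ℕ) :
    (incrementLaw (stepLaw k)).map
        (fun x (i : Fin (n + 1)) => ((limitWord (walk x)).1 i).residue)
      = Measure.pi fun _ => residueLaw w := by
  have := hw.isProbabilityMeasure_residueLaw
  refine Measure.ext_of_singleton fun e => ?_
  rw [Measure.map_apply (measurable_pi_lambda
    (fun x (i : Fin (n + 1)) => ((limitWord (walk x)).1 i).residue)
    fun i => measurable_residue_limitWord i) (.singleton e), Measure.pi_singleton]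
  simp only [residueLaw_singleton]
  have hcyl (c : Bool) :
      incrementLaw (stepLaw k) {x | ∀ i : Fin (n + 1),
        (limitWord (walk x)).1 i = letter (c ^^ (i : ℕ).bodd) (e i)}
        = ENNReal.ofReal ((∏ i, w (e i)) / 2) :=
    hw.measure_limitWord_cylinder hlen (fun i => letter (c ^^ (i : ℕ).bodd) (e i))
      fun i => by simp
  have hset : (fun x (i : Fin (n + 1)) => ((limitWord (walk x)).1 i).residue) ⁻¹' {e}
      = ⋃ c : Bool, {x | ∀ i : Fin (n + 1),
        (limitWord (walk x)).1 i = letter (c ^^ (i : ℕ).bodd) (e i)} := by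
    ext x
    simp [funext_iff, Boundary.forall_residue_eq_iff]
  have hdisj : Pairwise (Function.onFun Disjoint fun c : Bool => {x | ∀ i : Fin (n + 1),
      (limitWord (walk x)).1 i = letter (c ^^ (i : ℕ).bodd) (e i)}) := fun c c' hc =>
    Set.disjoint_left.2 fun x hx hx' => hc (by
      simpa using congrArg Letter.factor ((hx 0).symm.trans (hx' 0)))
  have hprod : 0 ≤ (∏ i, w (e i)) / 2 :=
    div_nonneg (Finset.prod_nonneg fun i _ => (hw.pos (e i)).le) zero_le_two
  rw [hset, measure_iUnion hdisj fun c => ?_, tsum_bool, hcyl, hcyl,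
    ← ENNReal.ofReal_add hprod hprod, add_halves,
    ENNReal.ofReal_prod_of_nonneg fun i _ => (hw.pos (e i)).le]
  simp only [Set.ofPred_forall]
  exact .iInter fun i => ((Boundary.measurable_apply i).comp measurable_limitWord_walk)
    (.of_discrete (s := {letter (c ^^ (i : ℕ).bodd) (e i)}))

lemma map_residue_limitWord (n : ℕ) :
    (incrementLaw (stepLaw k)).map (fun x => ((limitWord (walk x)).1 n).residue)
      = residueLaw w := by
  have := hw.isProbabilityMeasure_residueLaw
  exact ((measurePreserving_eval (fun _ : Fin (n + 1) => residueLaw w) (Fin.last n)).comp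
    ⟨measurable_pi_lambda _ fun i => measurable_residue_limitWord (i : ℕ),
      hw.map_residue_limitWord_fin hlen n⟩).map_eq

lemma indepFun_residue_limitWord {i j : ℕ} (hij : i ≠ j) :
    ProbabilityTheory.IndepFun (fun x => ((limitWord (walk x)).1 i).residue)
      (fun x => ((limitWord (walk x)).1 j).residue) (incrementLaw (stepLaw k)) := by
  have hindep : ProbabilityTheory.iIndepFun
      (fun (l : Fin (max i j + 1)) x => ((limitWord (walk x)).1 l).residue)
      (incrementLaw (stepLaw k)) := by
    rw [ProbabilityTheory.iIndepFun_iff_map_fun_eq_pi_map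
      fun l : Fin (max i j + 1) => (measurable_residue_limitWord (l : ℕ)).aemeasurable,
      hw.map_residue_limitWord_fin hlen]
    simp only [hw.map_residue_limitWord hlen]
  exact hindep.indepFun (i := ⟨i, by omega⟩) (j := ⟨j, by omega⟩) (by simpa using hij)

lemma ae_tendsto_average_limitWord (v : ZMod k → ℝ) (h0 : v 0 = 0) :
    ∀ᵐ x ∂incrementLaw (stepLaw k), Tendsto
      (fun n : ℕ => (∑ i ∈ Finset.range n, v ((limitWord (walk x)).1 i).residue) / n) atTop
      (𝓝 (∑ m, w m * v m)) := by
  set f : NonzeroResidue k → ℝ := fun m => v m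
  have hlaw := hw.map_residue_limitWord hlen
  have hf : Measurable f := .of_discrete
  have hmean : ∫ x, f ((limitWord (walk x)).1 0).residue ∂incrementLaw (stepLaw k)
      = ∑ m, w m * v m := by
    rw [← hw.integral_residueLaw v h0, ← hlaw 0,
      integral_map (measurable_residue_limitWord 0).aemeasurable hf.aestronglyMeasurable]
  rw [← hmean]
  refine ProbabilityTheory.strong_law_ae_real
    (fun i x => f ((limitWord (walk x)).1 i).residue) ?_
    (fun i j hij => (hw.indepFun_residue_limitWord hlen hij).comp hf hf) fun i => ?_
  · have hintegrable := integrable_residueLaw w f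
    rw [← hlaw 0] at hintegrable
    exact hintegrable.comp_measurable (measurable_residue_limitWord 0)
  · exact (ProbabilityTheory.IdentDistrib.mk (measurable_residue_limitWord i).aemeasurable
      (measurable_residue_limitWord 0).aemeasurable ((hlaw i).trans (hlaw 0).symm)).comp hf

end IsHittingWeight

end HarmonicMeasure

/-! ### The drift -/

section Drift

variable {k : ℕ} {w v : ZMod k → ℝ} {c : ℝ}

lemma tendsto_succ_div_of_tendsto_div {e : ℕ → ℕ} {γ : ℝ} (hγ : γ ≠ 0)
    (h : Tendsto (fun m : ℕ => (m : ℝ) / e m) atTop (𝓝 γ)) :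
    Tendsto (fun m => (e (m + 1) : ℝ) / e m) atTop (𝓝 1) := by
  have hsucc : Tendsto (fun m : ℕ => ((m : ℝ) + 1) / e (m + 1)) atTop (𝓝 γ) := by
    simpa [Function.comp_def] using h.comp (tendsto_add_atTop_nat 1)
  have hratio := (h.div hsucc hγ).div (tendsto_natCast_div_add_atTop (1 : ℝ)) one_ne_zero
  rw [div_self hγ, div_one] at hratio
  refine hratio.congr' ?_
  filter_upwards [eventually_ne_atTop 0, h.eventually_ne hγ, hsucc.eventually_ne hγ]
    with m hm hem hem'
  have : (e m : ℝ) ≠ 0 := fun h0 => hem (by rw [h0, div_zero])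
  have : (e (m + 1) : ℝ) ≠ 0 := fun h0 => hem' (by rw [h0, div_zero])
  have : (m : ℝ) + 1 ≠ 0 := by positivity
  simp only [Pi.div_apply]
  field_simp

lemma potential_eq_sum {g : ZkZk k} {ξ : Boundary k} {m : ℕ} (h : normalForm g = ξ.take m) :
    potential v g = ∑ i ∈ Finset.range m, v (ξ.1 i).residue := by
  rw [potential, h, Boundary.take, List.map_ofFn, List.sum_ofFn, Finset.sum_range]
  rfl

lemma IsPath.tendsto_len_div {X : ℕ → ZkZk k} {ξ : Boundary k} {E : ℝ} (hX : IsPath X)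
    (hlen : Tendsto (fun n => len (X n)) atTop atTop) (hξ : ConvergesTo X ξ)
    (hpot : Tendsto (fun n : ℕ => potential v (X n) / n) atTop (𝓝 c)) (hc : c ≠ 0)
    (havg : Tendsto (fun n : ℕ => (∑ i ∈ Finset.range n, v (ξ.1 i).residue) / n) atTop (𝓝 E))
    (hE : E ≠ 0) : Tendsto (fun n : ℕ => (len (X n) : ℝ) / n) atTop (𝓝 (c / E)) := by
  choose e hem hlast using exists_last_visit hX.len_zero hX.len_succ_le hlen
  have he : Tendsto e atTop atTop :=
    tendsto_atTop_mono (fun m => (hem m).symm.le.trans (hX.len_le (e m))) tendsto_id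
  have hdiv : Tendsto (fun m : ℕ => (m : ℝ) / e m) atTop (𝓝 (c / E)) := by
    refine ((hpot.comp he).div havg hE).congr' ?_
    filter_upwards [havg.eventually_ne hE] with m hm
    have hsum : ∑ i ∈ Finset.range m, v (ξ.1 i).residue ≠ 0 := fun h0 =>
      hm (by rw [h0, zero_div])
    simp only [Pi.div_apply, Function.comp_apply,
      potential_eq_sum (hξ.normalForm_eq_take hX (hem m) (hlast m))]
    rw [div_div_div_comm, div_self hsum, one_div_div]
  refine tendsto_div_of_succ_le_of_tendsto_div_subseq hX.len_succ_le he
    (tendsto_succ_div_of_tendsto_div (div_ne_zero hc hE) hdiv) ?_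
  simpa only [hem] using hdiv

lemma IsHittingWeight.isDrift [Fact (1 < k)] (hw : IsHittingWeight w) (hv : IsDriftPotential v c)
    (hc : 0 < c) : IsDrift (generators k) (stepLaw k) ((1 - w 1) / 2) := by
  have hlen := hw.ae_tendsto_len hv hc
  have hsum := hw.sum_mul_eq hv
  have hE : ∑ m, w m * v m ≠ 0 := fun h0 => by
    rw [h0, mul_zero] at hsum
    linarith
  have hratio : (1 - w 1) / 2 = c / ∑ m, w m * v m := by
    rw [div_eq_div_iff two_ne_zero hE]
    linarith
  refine isDrift_of_ae_tendsto ?_ ?_ <;> simp only [wordLength_generators]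
  · filter_upwards [ae_isPath_walk] with x hx using hx.len_le
  · filter_upwards [ae_isPath_walk, hlen, hw.ae_tendsto_potential_div hv,
      hw.ae_tendsto_average_limitWord hlen v hv.zero] with x hx hxlen hpot havg
    rw [hratio]
    exact hx.tendsto_len_div hxlen (hx.convergesTo_limitWord hxlen) hpot hc.ne' havg hE

end Drift

/-! ### The equation `F k x = 1` -/

section Polynomials

variable {k : ℕ} {q : ℝ}

/-- The `x` for which `q` and `q⁻¹` are the roots of the characteristic polynomial
`t ^ 2 - 2 * (2 - x) * t + 1` of the recurrence defining `F`. -/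
def ofCharRoot (q : ℝ) : ℝ := 2 - (q + q⁻¹) / 2

lemma two_mul_mul_two_sub_ofCharRoot (hq : q ≠ 0) : 2 * q * (2 - ofCharRoot q) = q ^ 2 + 1 := by
  rw [ofCharRoot]
  field_simp
  ring

lemma ofCharRoot_one : ofCharRoot 1 = 1 := by norm_num [ofCharRoot]

lemma ofCharRoot_one_third : ofCharRoot (1 / 3) = 1 / 3 := by norm_num [ofCharRoot]

lemma strictMonoOn_ofCharRoot : StrictMonoOn ofCharRoot (Set.Ioc 0 1) := by
  rintro p ⟨hp0, -⟩ q ⟨hq0, hq1⟩ hpq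
  have hdiff : ofCharRoot q - ofCharRoot p = (q - p) * (1 - p * q) / (2 * p * q) := by
    rw [ofCharRoot, ofCharRoot]
    field_simp
    ring
  have hprod : 0 < 1 - p * q := by nlinarith
  have := sub_pos.2 hpq
  exact sub_pos.1 (hdiff ▸ by positivity)

lemma continuousAt_ofCharRoot (hq : q ≠ 0) : ContinuousAt ofCharRoot q := by
  unfold ofCharRoot
  fun_prop (disch := assumption)

lemma ofCharRoot_lt_one (hq : q ∈ Set.Ioo 0 1) : ofCharRoot q < 1 :=
  (strictMonoOn_ofCharRoot ⟨hq.1, hq.2.le⟩ ⟨one_pos, le_rfl⟩ hq.2).trans_eq ofCharRoot_one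

lemma exists_ofCharRoot_eq {x : ℝ} (hx : x ∈ Set.Ioo 0 1) :
    ∃ q ∈ Set.Ioo 0 1, ofCharRoot q = x := by
  have hcont : ContinuousOn ofCharRoot (Set.Icc (1 / 4) 1) := fun q hq =>
    (continuousAt_ofCharRoot (by linarith [hq.1] : 0 < q).ne').continuousWithinAt
  have hx' : x ∈ Set.Ioo (ofCharRoot (1 / 4)) (ofCharRoot 1) := by
    rw [ofCharRoot_one]
    exact ⟨(by norm_num [ofCharRoot] : ofCharRoot (1 / 4) < 0).trans hx.1, hx.2⟩
  obtain ⟨q, hq, rfl⟩ := intermediate_value_Ioo (by norm_num) hcont hx'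
  exact ⟨q, ⟨by linarith [hq.1], hq.2⟩, rfl⟩

lemma F_ofCharRoot_mul (hq : q ≠ 0) (n : ℕ) :
    F n (ofCharRoot q) * q ^ n * (1 - q ^ 2)
      = (ofCharRoot q - q) * q + (1 - ofCharRoot q * q) * q ^ (2 * n) := by
  induction n using Nat.twoStepInduction with
  | zero => simp only [F]; ring
  | one => simp only [F]; ring
  | more n ih ih' =>
    calc F (n + 2) (ofCharRoot q) * q ^ (n + 2) * (1 - q ^ 2)
        = 2 * q * (2 - ofCharRoot q) * (F (n + 1) (ofCharRoot q) * q ^ (n + 1) * (1 - q ^ 2))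
          - q ^ 2 * (F n (ofCharRoot q) * q ^ n * (1 - q ^ 2)) := by simp only [F]; ring
      _ = _ := by rw [ih, ih', two_mul_mul_two_sub_ofCharRoot hq]; ring

/-- The palindromic polynomial whose zeros `q` in `(0, 1)` correspond, through
`x = ofCharRoot q`, to the solutions of `F k x = 1` in `(0, 1)`. -/
def rootPoly (k : ℕ) (q : ℝ) : ℝ := 1 + q ^ k - 2 * ∑ i ∈ Finset.Ico 1 k, q ^ i

lemma rootPoly_succ (hk : 1 ≤ k) (q : ℝ) : rootPoly (k + 1) q = rootPoly k q - q ^ k * (3 - q) := by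
  rw [rootPoly, rootPoly, Finset.sum_Ico_succ_top hk]
  ring

lemma one_sub_mul_rootPoly (hk : 1 ≤ k) (q : ℝ) :
    (1 - q) * rootPoly k q = 1 - 3 * q + q ^ k * (3 - q) := by
  induction k, hk using Nat.le_induction with
  | base => simp only [rootPoly, Finset.Ico_self, Finset.sum_empty]; ring
  | succ k hk ih => rw [rootPoly_succ hk, mul_sub, ih]; ring

lemma strictAntiOn_rootPoly (hk : 2 ≤ k) : StrictAntiOn (rootPoly k) (Set.Icc 0 1) := by
  intro p hp q hq hpq
  induction k, hk using Nat.le_induction with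
  | base =>
    have htwo (t : ℝ) : rootPoly 2 t = (1 - t) ^ 2 := by
      rw [rootPoly_succ le_rfl, rootPoly, Finset.Ico_self, Finset.sum_empty]
      ring
    rw [htwo, htwo]
    nlinarith [hp.1, hq.2]
  | succ k hk ih =>
    obtain ⟨j, rfl⟩ := Nat.exists_eq_add_of_le' (one_le_two.trans hk)
    have hfactor : p * (3 - p) ≤ q * (3 - q) := by nlinarith [hp.2, hq.2]
    have hterm : p ^ (j + 1) * (3 - p) ≤ q ^ (j + 1) * (3 - q) := by
      rw [pow_succ, pow_succ, mul_assoc, mul_assoc]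
      exact mul_le_mul (pow_le_pow_left₀ hp.1 hpq.le j) hfactor
        (mul_nonneg hp.1 (by linarith [hp.2])) (pow_nonneg hq.1 j)
    rw [rootPoly_succ (one_le_two.trans hk), rootPoly_succ (one_le_two.trans hk)]
    linarith

lemma rootPoly_eq_zero_of_F_eq_one (hk : 1 ≤ k) (hq : q ∈ Set.Ioo 0 1)
    (h : F k (ofCharRoot q) = 1) : rootPoly k q = 0 := by
  obtain ⟨hq0, hq1⟩ := hq
  have hF := F_ofCharRoot_mul hq0.ne' k
  have hchar := two_mul_mul_two_sub_ofCharRoot hq0.ne'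
  have hpow : q ^ k < 1 := pow_lt_one₀ hq0.le hq1 (by omega)
  rw [h, mul_comm 2 k, pow_mul] at hF
  have hzero : (1 - q ^ k) * q * (1 - q) * ((1 - q) * rootPoly k q) = 0 := by
    rw [one_sub_mul_rootPoly hk]
    linear_combination 2 * q * hF - (q - (q ^ k) ^ 2 * q) * hchar
  have hne : (1 - q ^ k) * q * (1 - q) ≠ 0 := by
    have := sub_pos.2 hq1
    have := sub_pos.2 hpow
    positivity
  exact ((mul_eq_zero.1 hzero).resolve_left hne |> mul_eq_zero.1).resolve_left (sub_pos.2 hq1).ne'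

/-- `q` is the zero of `rootPoly k` in `(0, 1)`. -/
structure IsCharRoot (k : ℕ) (q : ℝ) : Prop where
  mem_Ioo : q ∈ Set.Ioo 0 1
  root : rootPoly k q = 0

lemma exists_isCharRoot (hk : 3 ≤ k) : ∃ q, IsCharRoot k q := by
  have hzero : rootPoly k 0 = 1 := by
    have hsum : ∑ i ∈ Finset.Ico 1 k, (0 : ℝ) ^ i = 0 :=
      Finset.sum_eq_zero fun i hi => zero_pow (by have := Finset.mem_Ico.1 hi; omega)
    rw [rootPoly, hsum, zero_pow (by omega)]
    norm_num
  have hone : rootPoly k 1 < 0 := by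
    have : (3 : ℝ) ≤ k := by exact_mod_cast hk
    simp only [rootPoly, one_pow, Finset.sum_const, Nat.card_Ico, nsmul_eq_mul, mul_one]
    rw [Nat.cast_sub (by omega)]
    push_cast
    linarith
  have hcont : Continuous (rootPoly k) := by
    unfold rootPoly
    fun_prop
  obtain ⟨q, hq, hroot⟩ := intermediate_value_Ioo' zero_le_one hcont.continuousOn
    (show (0 : ℝ) ∈ Set.Ioo (rootPoly k 1) (rootPoly k 0) from ⟨hone, hzero ▸ one_pos⟩)
  exact ⟨q, hq, hroot⟩

namespace IsCharRoot

variable (h : IsCharRoot k q)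

include h

lemma pos : 0 < q := h.mem_Ioo.1

lemma lt_one : q < 1 := h.mem_Ioo.2

lemma mem_Icc : q ∈ Set.Icc 0 1 := ⟨h.pos.le, h.lt_one.le⟩

lemma mem_Ioc : q ∈ Set.Ioc 0 1 := ⟨h.pos, h.lt_one.le⟩

lemma two_le : 2 ≤ k := by
  have hq := h.pos
  have hroot := h.root
  by_contra! hk
  interval_cases k <;> norm_num [rootPoly] at hroot
  linarith

lemma three_mul_sub_one_eq : 3 * q - 1 = q ^ k * (3 - q) := by
  have hroot := one_sub_mul_rootPoly (one_le_two.trans h.two_le) q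
  rw [h.root, mul_zero] at hroot
  linarith

lemma one_third_lt : 1 / 3 < q := by
  have : 0 < q ^ k * (3 - q) := mul_pos (pow_pos h.pos k) (by linarith [h.lt_one])
  linarith [h.three_mul_sub_one_eq]

lemma ofCharRoot_pos : 0 < ofCharRoot q := by
  have := strictMonoOn_ofCharRoot (by norm_num) h.mem_Ioc h.one_third_lt
  rw [ofCharRoot_one_third] at this
  linarith

lemma F_eq {n m : ℕ} (hnm : n + m = k) :
    F n (ofCharRoot q) = (q ^ n + q ^ m) / (1 + q ^ k) := by
  have hq := h.pos
  have hF := F_ofCharRoot_mul hq.ne' n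
  have hsq : 0 < 1 - q ^ 2 := by nlinarith [h.lt_one]
  have hx : ofCharRoot q * q * (1 + q ^ k) = q ^ 2 + q ^ k := by
    linear_combination (-(1 + q ^ k) / 2) * two_mul_mul_two_sub_ofCharRoot hq.ne'
      + ((1 - q) / 2) * h.three_mul_sub_one_eq
  have hpow : q ^ k = q ^ n * q ^ m := by rw [← hnm, pow_add]
  rw [mul_comm 2 n, pow_mul] at hF
  rw [eq_div_iff (by positivity)]
  refine mul_right_cancel₀ (show q ^ n * (1 - q ^ 2) ≠ 0 by positivity) ?_
  linear_combination (1 + q ^ k) * hF + (1 - (q ^ n) ^ 2) * hx + (1 - q ^ 2) * hpow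

lemma F_symm {n m : ℕ} (hnm : n + m = k) : F n (ofCharRoot q) = F m (ofCharRoot q) := by
  rw [h.F_eq hnm, h.F_eq ((add_comm m n).trans hnm), add_comm]

lemma F_self : F k (ofCharRoot q) = 1 := h.F_symm (add_zero k)

lemma F_pos {n : ℕ} (hn : n ≤ k) : 0 < F n (ofCharRoot q) := by
  rw [h.F_eq (Nat.add_sub_cancel' hn)]
  have := h.pos
  positivity

lemma F_lt_one {n : ℕ} (hn0 : n ≠ 0) (hn : n < k) : F n (ofCharRoot q) < 1 := by
  have hnk := Nat.add_sub_cancel' hn.le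
  have hq := h.pos
  rw [h.F_eq hnk, div_lt_one (by positivity)]
  have hn1 : q ^ n < 1 := pow_lt_one₀ hq.le h.lt_one hn0
  have hm1 : q ^ (k - n) < 1 := pow_lt_one₀ hq.le h.lt_one (by omega)
  have hpow : q ^ k = q ^ n * q ^ (k - n) := by rw [← pow_add, hnk]
  nlinarith

lemma eq_ofCharRoot {x : ℝ} (hx0 : 0 < x) (hx1 : x < 1) (hx : F k x = 1) : x = ofCharRoot q := by
  obtain ⟨p, hp, rfl⟩ := exists_ofCharRoot_eq ⟨hx0, hx1⟩
  have hroot := rootPoly_eq_zero_of_F_eq_one (one_le_two.trans h.two_le) hp hx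
  rw [(strictAntiOn_rootPoly h.two_le).injOn ⟨hp.1.le, hp.2.le⟩ h.mem_Icc (hroot.trans h.root.symm)]

lemma lt_of_succ {p : ℝ} (h' : IsCharRoot (k + 1) p) : p < q := by
  refine ((strictAntiOn_rootPoly h'.two_le).lt_iff_gt h.mem_Icc h'.mem_Icc).1 ?_
  rw [h'.root, rootPoly_succ (one_le_two.trans h.two_le), h.root]
  have : 0 < q ^ k * (3 - q) := mul_pos (pow_pos h.pos k) (by linarith [h.lt_one])
  linarith

end IsCharRoot

lemma strictAntiOn_of_isCharRoot {q : ℕ → ℝ} (h : ∀ k, 3 ≤ k → IsCharRoot k (q k)) :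
    StrictAntiOn q (Set.Ici 3) :=
  strictAntiOn_of_add_one_lt Set.ordConnected_Ici fun k _ hk hk' =>
    (h k hk).lt_of_succ (h (k + 1) hk')

lemma tendsto_of_isCharRoot {q : ℕ → ℝ} (h : ∀ k, 3 ≤ k → IsCharRoot k (q k)) :
    Tendsto q atTop (𝓝 (1 / 3)) := by
  have hpow : Tendsto (fun k => 1 / 3 + q 3 ^ k) atTop (𝓝 (1 / 3)) := by
    have := (tendsto_pow_atTop_nhds_zero_of_lt_one (h 3 le_rfl).pos.le
      (h 3 le_rfl).lt_one).const_add (1 / 3)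
    rwa [add_zero] at this
  refine tendsto_of_tendsto_of_tendsto_of_le_of_le' tendsto_const_nhds hpow ?_ ?_
  · filter_upwards [eventually_ge_atTop 3] with k hk using (h k hk).one_third_lt.le
  · filter_upwards [eventually_ge_atTop 3] with k hk
    have hq := (h k hk).pos
    have hle : q k ^ k ≤ q 3 ^ k := pow_le_pow_left₀ hq.le
      ((strictAntiOn_of_isCharRoot h).antitoneOn Set.self_mem_Ici hk hk) k
    nlinarith [(h k hk).three_mul_sub_one_eq, pow_pos hq k]

lemma strictAntiOn_ofCharRoot_of_isCharRoot {q : ℕ → ℝ} (h : ∀ k, 3 ≤ k → IsCharRoot k (q k)) :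
    StrictAntiOn (fun k => ofCharRoot (q k)) (Set.Ici 3) := fun k hk l hl hkl =>
  strictMonoOn_ofCharRoot (h l hl).mem_Ioc (h k hk).mem_Ioc
    (strictAntiOn_of_isCharRoot h hk hl hkl)

lemma tendsto_ofCharRoot_of_isCharRoot {q : ℕ → ℝ} (h : ∀ k, 3 ≤ k → IsCharRoot k (q k)) :
    Tendsto (fun k => ofCharRoot (q k)) atTop (𝓝 (1 / 3)) := by
  have hcont := (continuousAt_ofCharRoot (q := 1 / 3) (by norm_num)).tendsto
  rw [ofCharRoot_one_third] at hcont
  exact hcont.comp (tendsto_of_isCharRoot h)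

end Polynomials

/-! ### The hitting weight and the drift potential -/

section ZModVal

variable {α : Type*} {k : ℕ} {f : ℕ → α}

lemma apply_val_natCast (hf : f k = f 0) {n : ℕ} (hn : n ≤ k) : f (n : ZMod k).val = f n := by
  obtain rfl | hlt := hn.eq_or_lt
  · rw [ZMod.natCast_self, ZMod.val_zero, hf]
  · rw [ZMod.val_natCast_of_lt hlt]

variable [NeZero k]

lemma apply_val_add_one (hf : f k = f 0) (m : ZMod k) : f (m + 1).val = f (m.val + 1) := by
  rw [← apply_val_natCast hf (n := m.val + 1) m.val_lt, Nat.cast_add,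
    ZMod.natCast_zmod_val, Nat.cast_one]

lemma apply_val_sub_one (hf : f k = f 0) {m : ZMod k} (hm : m ≠ 0) :
    f (m - 1).val = f (m.val - 1) := by
  have hm1 : 1 ≤ m.val := ZMod.val_pos.2 hm
  rw [← apply_val_natCast hf ((Nat.sub_le _ _).trans m.val_le), Nat.cast_sub hm1,
    ZMod.natCast_zmod_val, Nat.cast_one]

lemma apply_val_neg (hf : f k = f 0) (m : ZMod k) : f (-m).val = f (k - m.val) := by
  rw [← apply_val_natCast hf (Nat.sub_le k _), Nat.cast_sub m.val_le, ZMod.natCast_self,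
    ZMod.natCast_zmod_val, zero_sub]

end ZModVal

section Weights

variable {k : ℕ} [Fact (1 < k)]

lemma IsCharRoot.isHittingWeight {q : ℝ} (h : IsCharRoot k q) :
    IsHittingWeight fun m : ZMod k => F m.val (ofCharRoot q) := by
  have hper : F k (ofCharRoot q) = F 0 (ofCharRoot q) := h.F_self
  refine ⟨by rw [ZMod.val_zero, F], fun m => ?_, fun m => h.F_pos m.val_le,
    fun m hm => h.F_lt_one (ZMod.val_ne_zero _ |>.2 hm) m.val_lt, fun m hm => ?_⟩
  · rw [apply_val_neg (f := fun n => F n (ofCharRoot q)) hper]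
    exact h.F_symm (Nat.sub_add_cancel m.val_le)
  · rw [apply_val_add_one (f := fun n => F n (ofCharRoot q)) hper,
      apply_val_sub_one (f := fun n => F n (ofCharRoot q)) hper hm, ZMod.val_one]
    obtain ⟨n, hn⟩ := Nat.exists_eq_add_of_le' (ZMod.val_pos.2 hm)
    rw [hn]
    simp only [F, Nat.add_sub_cancel]
    ring

/-- The quadratic function `n (k - n)` on the residues modulo `k`. -/
def quadratic (k : ℕ) (m : ZMod k) : ℝ := m.val * (k - m.val)

lemma isDriftPotential_quadratic : IsDriftPotential (quadratic k) ((k - 2) / 2) := by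
  set f : ℕ → ℝ := fun n => n * (k - n) with hf
  have hper : f k = f 0 := by simp [hf]
  refine ⟨by simp [quadratic], fun m hm => ?_⟩
  change f (m + 1).val + f (m - 1).val + f (1 : ZMod k).val + f (-1 : ZMod k).val
    = 2 * f m.val + 4 * ((k - 2) / 2)
  rw [apply_val_add_one hper, apply_val_sub_one hper hm, apply_val_neg hper, ZMod.val_one]
  obtain ⟨n, hn⟩ := Nat.exists_eq_add_of_le' (ZMod.val_pos.2 hm)
  have hk : 1 ≤ k := (Fact.out : 1 < k).le
  simp only [hf, hn, Nat.add_sub_cancel, Nat.cast_sub hk]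
  push_cast
  ring

end Weights

end FreeProductWalk

end

theorem mainTheorem1 :
    ∃ x γ : ℕ → ℝ,
      (∀ k : ℕ, 3 ≤ k →
        (0 < x k ∧ x k < 1 ∧ FreeProductWalk.F k (x k) = 1 ∧
          ∀ y : ℝ, 0 < y → y < 1 → FreeProductWalk.F k y = 1 → y = x k) ∧
        (∃ ν : MeasureTheory.Measure (FreeProductWalk.Boundary k),
          FreeProductWalk.IsHarmonicMeasure (FreeProductWalk.stepLaw k) ν ∧
          FreeProductWalk.IsMarkovianMultiplicative
            (fun s : FreeProductWalk.Letter k => FreeProductWalk.F s.exponent (x k) / 2) ν) ∧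
        FreeProductWalk.IsDrift (FreeProductWalk.generators k) (FreeProductWalk.stepLaw k) (γ k) ∧
        γ k = (1 - x k) / 2) ∧
      StrictMonoOn γ (Set.Ici 3) ∧
      Filter.Tendsto γ Filter.atTop (nhds (1 / 3)) := by
  choose! q hq using fun k => FreeProductWalk.exists_isCharRoot (k := k)
  refine ⟨fun k => FreeProductWalk.ofCharRoot (q k),
    fun k => (1 - FreeProductWalk.ofCharRoot (q k)) / 2, fun k hk => ?_, ?_, ?_⟩
  · have : Fact (1 < k) := ⟨by omega⟩
    have hroot := hq k hk
    have hw := hroot.isHittingWeight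
    have hv := FreeProductWalk.isDriftPotential_quadratic (k := k)
    have hc : 0 < ((k : ℝ) - 2) / 2 := half_pos (sub_pos.2 (by exact_mod_cast hk))
    have hlen := hw.ae_tendsto_len hv hc
    exact ⟨⟨hroot.ofCharRoot_pos, FreeProductWalk.ofCharRoot_lt_one hroot.mem_Ioo, hroot.F_self,
        fun y => hroot.eq_ofCharRoot⟩,
      ⟨_, FreeProductWalk.isHarmonicMeasure_map_limitWord hlen,
        hw.isMarkovianMultiplicative hlen⟩,
      by simpa only [ZMod.val_one, FreeProductWalk.F] using hw.isDrift hv hc, rfl⟩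
  · exact fun k hk l hl hkl => div_lt_div_of_pos_right
      (sub_lt_sub_left (FreeProductWalk.strictAntiOn_ofCharRoot_of_isCharRoot hq hk hl hkl) 1)
      two_pos
  · have hlim : (1 / 3 : ℝ) = (1 - 1 / 3) / 2 := by norm_num
    rw [hlim]
    exact ((FreeProductWalk.tendsto_ofCharRoot_of_isCharRoot hq).const_sub 1).div_const 2
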